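/- **Setting.** Let $\mathcal K$ be a simplicial complex on a vertex set $V$ (all singletons being simplices), with $\mathcal K_n$ the set of its $n$-simplices. Assume $\mathcal K_n=\emptyset$ for $n>N$, and that every simplex $x\in\mathcal K_n$ is a face of at most $L$ simplices of $\mathcal K_{n+1}$, where $N,L\in\mathbb N$. Fix an orientation of every simplex (vertices having only one), let $\epsilon_{x,y}\in\{0,\pm1\}$ be the incidence numbers, let $\mathcal C_n$ be the free abelian group on $\mathcal K_n$, and put $\partial x=\sum_{y}\epsilon_{x,y}\,y$ and $\widehat\partial x=\sum_z\epsilon_{z,x}\,z$. Let $(\mathbb G_\bullet,\partial^{\mathbb G})$ be a chain complex of finite abelian groups $\mathbb G_j$, $j\in\mathbb Z$, with $\mathbb G_j=0$ for $j<0$ and $j>N$. Let $\widehat{\mathbb G}_j$ be the group of characters of $\mathbb G_j$, written additively, and $\widehat\partial^{\mathbb G}\alpha=\alpha\circ\partial^{\mathbb G}$. Let ${\rm Hom}_0(\mathcal C,\mathbb G)^p$ (resp. ${\rm Hom}_0(\mathcal C,\mathbb G)_p$) be the group of all families of homomorphisms $t_n:\mathcal C_n\to\mathbb G_{n-p}$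 (resp. $\gamma_n:\mathcal C_n\to\widehat{\mathbb G}_{n-p}$) that vanish on all but finitely many simplices; compatibility with the differentials is not required. Define $$(\delta^pt)_n=t_{n-1}\circ\partial_n-(-1)^p\,\partial^{\mathbb G}_{n-p}\circ t_n,\qquad(\delta_p\gamma)_n=\gamma_{n+1}\circ\widehat\partial_{n+1}-(-1)^{p-1}\,\widehat\partial^{\mathbb G}_{n+1-p}\circ\gamma_n ,$$ with values in ${\rm Hom}_0(\mathcal C,\mathbb G)^{p+1}$ and ${\rm Hom}_0(\mathcal C,\mathbb G)_{p-1}$ respectively. For $x\in\mathcal K_n$ let $\mathfrak h_x=L^2(\mathbb G_n)$. For finite $\Lambda\subset\mathcal K$ let $\mathfrak A_\Lambda=\mathcal B(\bigotimes_{x\in\Lambda}\mathfrak h_x)$, with the inclusions $A\mapsto A\otimes 1$; let $\mathfrak A_{\rm loc}=\bigcup_\Lambda\mathfrak A_\Lambda$ and let $\mathfrak A$ be its C*-completion. For $t\in{\rm Hom}_0(\mathcal C,\mathbb G)^0$ and $\gamma\in{\rm Hom}_0(\mathcal C,\mathbb G)_0$ let $P_t|c\rangle=|c+t\rangle$ and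 $Q_\gamma|c\rangle=\prod_x\gamma(x)[c(x)]\,|c\rangle$. Put $A_t=P_{\delta^{-1}t}$ for $t\in{\rm Hom}_0(\mathcal C,\mathbb G)^{-1}$ and $B_\gamma=Q_{\delta_1\gamma}$ for $\gamma\in{\rm Hom}_0(\mathcal C,\mathbb G)_1$. For $x\in\mathcal K_n$ let $$A_x^0=\frac1{|\mathbb G_{n+1}|}\sum_{g\in\mathbb G_{n+1}}A_{x^*_g},\qquad B_x^0=\frac1{|\mathbb G_{n-1}|}\sum_{\alpha\in\widehat{\mathbb G}_{n-1}}B_{x_*^\alpha},$$ where $x^*_g$ (resp. $x_*^\alpha$) takes the value $g$ (resp. $\alpha$) at $x$ and $0$ at all other simplices. Put ${\rm supp}(A_x^0)=\{x\}\cup\{z:\epsilon_{z,x}\ne0\}$ and ${\rm supp}(B_x^0)=\{x\}\cup\{y:\epsilon_{x,y}\neq0\}$. For finite $\Lambda\subset\mathcal K$ let $$H^\Lambda=-\Big(\sum_{{\rm supp}(A_x^0)\subseteq\Lambda}A_x^0+\sum_{{\rm supp}(B_y^0)\subseteq\Lambda}B_y^0\Big),$$ and for $A\in\mathfrak A_{\rm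 loc}$ let $\delta(A)=i[H^\Lambda,A]$ for all sufficiently large finite $\Lambda$. A state of a unital C*-algebra is a positive linear functional $\omega$ with $\omega(1)=1$; it is pure if it is an extreme point of the set of states. A ground state is a state $\omega$ of $\mathfrak A$ with $-i\,\omega(A^*\delta(A))\ge0$ for all $A\in\mathfrak A_{\rm loc}$. It is frustration-free if $\omega(A_x^0)=\omega(B_y^0)=1$ for all $x,y\in\mathcal K$. The core algebra $\mathfrak K\subset\mathfrak A$ is the C*-subalgebra generated by all $A_t$ and $B_\gamma$ with $t\in{\rm Hom}_0(\mathcal C,\mathbb G)^{-1}$, $\gamma\in{\rm Hom}_0(\mathcal C,\mathbb G)_1$. **Statement.** 1. Frustration-free ground states exist, and there exist frustration-free ground states that are pure states of $\mathfrak A$. 2. There is exactly one state $\vartheta$ of $\mathfrak K$ (the seed state) with $\vartheta(A_tB_\gamma)=1$ for all $t\in{\rm Hom}_0(\mathcal C,\mathbb G)^{-1}$ and $\gamma\in{\rm Hom}_0(\mathcal C,\mathbb G)_1$, and $\vartheta$ is pure. 3. For every state $\omega_0$ of $\mathfrak A$ the following are equivalent: (a) $\omega_0$ is a frustration-free ground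 state; (b) $\omega_0|_{\mathfrak K}=\vartheta$; (c) $\omega_0(A_tB_\gamma)=1$ for all $t\in{\rm Hom}_0(\mathcal C,\mathbb G)^{-1}$ and $\gamma\in{\rm Hom}_0(\mathcal C,\mathbb G)_1$. -/

import Mathlib

open scoped ComplexOrder

noncomputable section

set_option linter.unusedSectionVars false

namespace QDM

/-! ### The quasi-local algebra of a family of finite-dimensional sites -/

section Sites

variable {ι : Type*} (G : ι → Type*) [∀ i, AddCommGroup (G i)] [∀ i, Finite (G i)]

/-- Assignments of a group element to every site. -/
abbrev Conf : Type _ := ∀ i, G i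

/-- Assignments of a group element to every site of the finite set `Λ`. -/
abbrev LocConf (Λ : Finset ι) : Type _ := ∀ i : Λ, G i

instance (Λ : Finset ι) : Fintype (LocConf G Λ) := Fintype.ofFinite _

instance (Λ : Finset ι) : DecidableEq (LocConf G Λ) := Classical.decEq _

/-- The Hilbert space `𝔥_Λ = ⨂_{x ∈ Λ} L²(G_x) = L²(∏_{x ∈ Λ} G_x)`, with orthonormal basis `|a⟩`,
`a ∈ ∏_{x ∈ Λ} G_x`. -/
abbrev LocHilb (Λ : Finset ι) : Type _ := EuclideanSpace ℂ (LocConf G Λ)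

/-- The Hilbert space `ℓ²(∏_x G_x)`. For every finite `Λ` it is
`𝔥_Λ ⊗ ℓ²(∏_{x ∉ Λ} G_x)`; it carries all the algebras `B(𝔥_Λ) ⊗ 1` at once. -/
abbrev Hilb : Type _ := lp (fun _ : Conf G => ℂ) 2

variable {G}

/-- The restriction of a configuration to `Λ`. -/
def restr (Λ : Finset ι) (c : Conf G) : LocConf G Λ := fun i => c i

open Classical in
/-- The configuration equal to `a` on `Λ` and to `c` off `Λ`. -/
def glue (Λ : Finset ι) (c : Conf G) (a : LocConf G Λ) : Conf G :=
  fun i => if h : i ∈ Λ then a ⟨i, h⟩ else c i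

@[simp] theorem restr_glue (Λ : Finset ι) (c : Conf G) (a : LocConf G Λ) :
    restr Λ (glue Λ c a) = a := by
  funext i; simp [restr, glue]

@[simp] theorem glue_glue (Λ : Finset ι) (c : Conf G) (a b : LocConf G Λ) :
    glue Λ (glue Λ c a) b = glue Λ c b := by
  funext i; by_cases h : i ∈ Λ <;> simp [glue, h]

@[simp] theorem glue_restr (Λ : Finset ι) (c : Conf G) : glue Λ c (restr Λ c) = c := by
  funext i; by_cases h : i ∈ Λ <;> simp [glue, restr, h]

theorem summable_sq (f : Hilb G) : Summable fun c => ‖f c‖ ^ 2 := by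
  have h := (lp.memℓp f).summable (by norm_num)
  simpa using h

theorem norm_sq_eq (f : Hilb G) : ‖f‖ ^ 2 = ∑' c, ‖f c‖ ^ 2 := by
  have h := lp.norm_rpow_eq_tsum (p := 2) (by norm_num) f
  simpa using h

theorem memlp_of_sq {f : Conf G → ℂ} (h : Summable fun c => ‖f c‖ ^ 2) : Memℓp f 2 := by
  apply memℓp_gen
  simpa using h

theorem mulShift_aux (φ : Conf G → ℂ) (C : ℝ) (hφ : ∀ c, ‖φ c‖ ≤ C) (s : Conf G) (f : Hilb G) :
    (Summable fun c => ‖φ c * f (c - s)‖ ^ 2) ∧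
      ∑' c, ‖φ c * f (c - s)‖ ^ 2 ≤ (C * ‖f‖) ^ 2 := by
  have h1 : Summable fun c => ‖f (c - s)‖ ^ 2 :=
    (Equiv.subRight s).summable_iff.mpr (summable_sq f)
  have h2 : ∀ c, ‖φ c * f (c - s)‖ ^ 2 ≤ C ^ 2 * ‖f (c - s)‖ ^ 2 := fun c => by
    rw [norm_mul, mul_pow]
    gcongr
    exact hφ c
  have h3 := Summable.of_nonneg_of_le (fun c => by positivity) h2 (h1.mul_left _)
  refine ⟨h3, (h3.tsum_le_tsum h2 (h1.mul_left _)).trans ?_⟩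
  rw [tsum_mul_left, mul_pow, norm_sq_eq]
  exact le_of_eq (congrArg _ ((Equiv.subRight s).tsum_eq fun c => ‖f c‖ ^ 2))

open Classical in
/-- The bounded operator `|c⟩ ↦ φ (c + s) |c + s⟩`, that is `f ↦ (c ↦ φ c * f (c - s))`,
for a bounded function `φ` (and `0` for an unbounded one). -/
def mulShift (φ : Conf G → ℂ) (s : Conf G) : Hilb G →L[ℂ] Hilb G :=
  if h : ∃ C, ∀ c, ‖φ c‖ ≤ C then
    LinearMap.mkContinuous
      { toFun := fun f => ⟨fun c => φ c * f (c - s),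
          memlp_of_sq (mulShift_aux φ _ h.choose_spec s f).1⟩
        map_add' := fun f g => by ext c; exact mul_add _ _ _
        map_smul' := fun a f => by ext c; simp; ring }
      h.choose fun f => by
        have hC : 0 ≤ h.choose := (norm_nonneg _).trans (h.choose_spec 0)
        refine abs_le_of_sq_le_sq' ?_ (by positivity) |>.2
        rw [norm_sq_eq]
        exact (mulShift_aux φ _ h.choose_spec s f).2
  else 0

theorem mulShift_apply {φ : Conf G → ℂ} (h : ∃ C, ∀ c, ‖φ c‖ ≤ C) (s : Conf G) (f : Hilb G)
    (c : Conf G) : mulShift φ s f c = φ c * f (c - s) := by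
  simp [mulShift, h]

/-- The shift operator `|c⟩ ↦ |c + s⟩`. -/
def shift (s : Conf G) : Hilb G →L[ℂ] Hilb G := mulShift (fun _ => 1) s

/-- The multiplication operator `|c⟩ ↦ φ c |c⟩` by a bounded function `φ`. -/
def diag (φ : Conf G → ℂ) : Hilb G →L[ℂ] Hilb G := mulShift φ 0

theorem shift_apply (s : Conf G) (f : Hilb G) (c : Conf G) : shift s f c = f (c - s) := by
  rw [shift, mulShift_apply ⟨1, by simp⟩]; simp

theorem diag_apply {φ : Conf G → ℂ} (h : ∃ C, ∀ c, ‖φ c‖ ≤ C) (f : Hilb G) (c : Conf G) :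
    diag φ f c = φ c * f c := by
  rw [diag, mulShift_apply h]; simp

/-- The configuration equal to `s` on `Λ` and to `0` off `Λ`. -/
def extZero (Λ : Finset ι) (s : LocConf G Λ) : Conf G := glue Λ 0 s

/-- The operator `M ⊗ 1` on `ℓ²(∏_x G_x) = 𝔥_Λ ⊗ ℓ²(∏_{x ∉ Λ} G_x)` for a matrix `M` in the
basis `|a⟩` of `𝔥_Λ`; its coordinates are given in `amplify_apply`. -/
def amplify (Λ : Finset ι) (M : Matrix (LocConf G Λ) (LocConf G Λ) ℂ) : Hilb G →L[ℂ] Hilb G :=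
  ∑ s : LocConf G Λ, mulShift (fun c => M (restr Λ c) (restr Λ c - s)) (extZero Λ s)

theorem amplify_apply (Λ : Finset ι) (M : Matrix (LocConf G Λ) (LocConf G Λ) ℂ) (f : Hilb G)
    (c : Conf G) :
    amplify Λ M f c = ∑ b : LocConf G Λ, M (restr Λ c) b * f (glue Λ c b) := by
  have hb : ∀ s : LocConf G Λ, ∃ C, ∀ c : Conf G, ‖M (restr Λ c) (restr Λ c - s)‖ ≤ C := by
    intro s
    refine ⟨∑ a, ‖M a (a - s)‖, fun c => ?_⟩
    exact Finset.single_le_sum (f := fun a => ‖M a (a - s)‖) (fun _ _ => norm_nonneg _)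
      (Finset.mem_univ (restr Λ c))
  have : amplify Λ M f c =
      ∑ s : LocConf G Λ, M (restr Λ c) (restr Λ c - s) * f (c - extZero Λ s) := by
    simp only [amplify, _root_.sum_apply, lp.coeFn_sum, Finset.sum_apply]
    exact Finset.sum_congr rfl fun s _ => mulShift_apply (hb s) _ _ _
  rw [this]
  refine Fintype.sum_equiv (Equiv.subLeft (restr Λ c)) _ _ fun s => ?_
  simp only [Equiv.subLeft_apply]
  have : c - extZero Λ s = glue Λ c (restr Λ c - s) := by
    funext i
    by_cases h : i ∈ Λ <;> simp [glue, extZero, restr, h]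
  rw [this]

theorem star_mulShift {φ : Conf G → ℂ} (h : ∃ C, ∀ c, ‖φ c‖ ≤ C) (s : Conf G) :
    star (mulShift φ s) = mulShift (fun c => star (φ (c + s))) (-s) := by
  have h' : ∃ C, ∀ c, ‖star (φ (c + s))‖ ≤ C := h.imp fun C hC c => by
    rw [norm_star]; exact hC _
  rw [ContinuousLinearMap.star_eq_adjoint, eq_comm, ContinuousLinearMap.eq_adjoint_iff]
  intro f g
  rw [lp.inner_eq_tsum, lp.inner_eq_tsum, ← (Equiv.subRight s).tsum_eq]
  refine tsum_congr fun c => ?_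
  simp only [mulShift_apply h, mulShift_apply h', Equiv.subRight_apply, RCLike.inner_apply]
  simp
  ring

theorem amplify_adj (Λ : Finset ι) (M : Matrix (LocConf G Λ) (LocConf G Λ) ℂ) :
    amplify Λ (star M) = star (amplify Λ M) := by
  unfold amplify
  rw [star_sum]
  refine Fintype.sum_equiv (Equiv.neg _) _ _ fun s => ?_
  have hb : ∃ C, ∀ c : Conf G, ‖M (restr Λ c) (restr Λ c - -s)‖ ≤ C := by
    refine ⟨∑ a, ‖M a (a - -s)‖, fun c => ?_⟩
    exact Finset.single_le_sum (f := fun a => ‖M a (a - -s)‖) (fun _ _ => norm_nonneg _)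
      (Finset.mem_univ (restr Λ c))
  have hs : extZero Λ (-s) = -extZero Λ s := by
    funext i; by_cases h : i ∈ Λ <;> simp [extZero, glue, h]
  simp only [Equiv.neg_apply]
  rw [star_mulShift hb, hs, neg_neg]
  congr 1
  funext c
  have : restr Λ (c + -extZero Λ s) = restr Λ c - s := by
    funext i; simp [extZero, glue, restr, sub_eq_add_neg]
  rw [this, Matrix.star_apply]
  simp

/-- `M ↦ M ⊗ 1` as a *-homomorphism. -/
def amplifyHom (Λ : Finset ι) :
    Matrix (LocConf G Λ) (LocConf G Λ) ℂ →⋆ₐ[ℂ] (Hilb G →L[ℂ] Hilb G) where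
  toFun := amplify Λ
  map_one' := by
    ext f c
    simp [amplify_apply, Matrix.one_apply]
  map_mul' := fun M N => by
    ext f c
    simp only [amplify_apply, mul_apply_eq_comp, restr_glue, glue_glue,
      Matrix.mul_apply, Finset.sum_mul, Finset.mul_sum]
    rw [Finset.sum_comm]
    simp only [mul_assoc]
  map_zero' := by
    ext f c
    simp [amplify_apply]
  map_add' := fun M N => by
    ext f c
    simp [amplify_apply, add_mul, Finset.sum_add_distrib]
  commutes' := fun r => by
    ext f c
    simp [amplify_apply, Matrix.one_apply, Algebra.algebraMap_eq_smul_one]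
  map_star' := amplify_adj Λ

/-- The inclusion `B(𝔥_Λ) → B(𝔥_Λ) ⊗ 1`, `A ↦ A ⊗ 1`. -/
def locEmb (Λ : Finset ι) :
    (LocHilb G Λ →L[ℂ] LocHilb G Λ) →⋆ₐ[ℂ] (Hilb G →L[ℂ] Hilb G) :=
  (amplifyHom Λ).comp
    (Matrix.toEuclideanCLM (n := LocConf G Λ) (𝕜 := ℂ)).symm.toStarAlgHom

/-- The algebra `𝔄_Λ = B(𝔥_Λ)`, identified with `B(𝔥_Λ) ⊗ 1`. -/
def localAlg (Λ : Finset ι) : StarSubalgebra ℂ (Hilb G →L[ℂ] Hilb G) := (locEmb Λ).range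

theorem amplify_mem (Λ : Finset ι) (M : Matrix (LocConf G Λ) (LocConf G Λ) ℂ) :
    amplify Λ M ∈ localAlg Λ :=
  ⟨Matrix.toEuclideanCLM (n := LocConf G Λ) (𝕜 := ℂ) M, by simp [locEmb, amplifyHom]⟩

theorem exists_amplify {Λ : Finset ι} {A : Hilb G →L[ℂ] Hilb G} (hA : A ∈ localAlg Λ) :
    ∃ M, A = amplify Λ M := by
  obtain ⟨B, rfl⟩ := hA
  exact ⟨_, rfl⟩

theorem mulShift_mem {Λ : Finset ι} {φ : Conf G → ℂ} {s : Conf G}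
    (hφ : ∀ c c', restr Λ c = restr Λ c' → φ c = φ c') (hs : ∀ i ∉ Λ, s i = 0) :
    mulShift φ s ∈ localAlg Λ := by
  have hb : ∃ C, ∀ c, ‖φ c‖ ≤ C := by
    refine ⟨∑ a : LocConf G Λ, ‖φ (extZero Λ a)‖, fun c => ?_⟩
    rw [hφ c (extZero Λ (restr Λ c)) (by simp [extZero])]
    exact Finset.single_le_sum (f := fun a => ‖φ (extZero Λ a)‖) (fun _ _ => norm_nonneg _)
      (Finset.mem_univ (restr Λ c))
  suffices h : mulShift φ s =
      amplify Λ (Matrix.of fun a b => if b = a - restr Λ s then φ (extZero Λ a) else 0) by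
    rw [h]; exact amplify_mem _ _
  ext f c
  rw [mulShift_apply hb, amplify_apply]
  simp only [Matrix.of_apply, ite_mul, zero_mul, Finset.sum_ite_eq', Finset.mem_univ, if_true]
  rw [hφ c (extZero Λ (restr Λ c)) (by simp [extZero])]
  have : c - s = glue Λ c (restr Λ c - restr Λ s) := by
    funext i
    by_cases h : i ∈ Λ
    · simp [glue, restr, h]
    · simp [glue, h, hs i h]
  rw [this]

/-- The local algebras form an increasing net. -/
theorem localAlg_mono {Λ Λ' : Finset ι} (h : Λ ⊆ Λ') :
    localAlg (G := G) Λ ≤ localAlg Λ' := by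
  intro A hA
  obtain ⟨M, rfl⟩ := exists_amplify hA
  refine sum_mem fun s _ => mulShift_mem ?_ ?_
  · intro c c' hc
    have : restr Λ c = restr Λ c' := by
      funext i
      exact congrFun hc ⟨i, h i.2⟩
    rw [this]
  · intro i hi
    have : i ∉ Λ := fun h' => hi (h h')
    simp [extZero, glue, this]

variable (G) in
/-- The local algebra `𝔄_loc = ⋃_Λ 𝔄_Λ`. -/
def locAlg : StarSubalgebra ℂ (Hilb G →L[ℂ] Hilb G) := ⨆ Λ : Finset ι, localAlg Λ

theorem mem_locAlg {A : Hilb G →L[ℂ] Hilb G} : A ∈ locAlg G ↔ ∃ Λ, A ∈ localAlg Λ := by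
  constructor
  · intro h
    let S : StarSubalgebra ℂ (Hilb G →L[ℂ] Hilb G) :=
      { carrier := {A | ∃ Λ, A ∈ localAlg Λ}
        mul_mem' := by
          classical
          rintro A B ⟨Λ, hA⟩ ⟨Λ', hB⟩
          exact ⟨Λ ∪ Λ', mul_mem (localAlg_mono Finset.subset_union_left hA)
            (localAlg_mono Finset.subset_union_right hB)⟩
        add_mem' := by
          classical
          rintro A B ⟨Λ, hA⟩ ⟨Λ', hB⟩
          exact ⟨Λ ∪ Λ', add_mem (localAlg_mono Finset.subset_union_left hA)
            (localAlg_mono Finset.subset_union_right hB)⟩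
        algebraMap_mem' := fun r => ⟨∅, algebraMap_mem _ r⟩
        star_mem' := by
          rintro A ⟨Λ, hA⟩
          exact ⟨Λ, star_mem hA⟩ }
    have : locAlg G ≤ S := iSup_le fun Λ A hA => ⟨Λ, hA⟩
    exact this h
  · rintro ⟨Λ, h⟩
    exact (le_iSup (fun Λ => localAlg (G := G) Λ) Λ) h

variable (G) in
/-- The quasi-local algebra `𝔄`: the norm closure of `𝔄_loc`. -/
def quasiLocal : StarSubalgebra ℂ (Hilb G →L[ℂ] Hilb G) := (locAlg G).topologicalClosure

theorem localAlg_le (Λ : Finset ι) : localAlg Λ ≤ quasiLocal G :=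
  (le_iSup (fun Λ => localAlg (G := G) Λ) Λ).trans (StarSubalgebra.le_topologicalClosure _)

/-- An operator of `𝔄_Λ` commutes with operators supported off `Λ`. -/
theorem commute_of_disjoint {Λ : Finset ι} {A : Hilb G →L[ℂ] Hilb G} (hA : A ∈ localAlg Λ)
    {φ : Conf G → ℂ} {s : Conf G} (hb : ∃ C, ∀ c, ‖φ c‖ ≤ C)
    (hφ : ∀ c a, φ (glue Λ c a) = φ c) (hs : ∀ i ∈ Λ, s i = 0) :
    Commute (mulShift φ s) A := by
  obtain ⟨M, rfl⟩ := exists_amplify hA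
  ext f c
  simp only [mul_apply_eq_comp, mulShift_apply hb, amplify_apply, Finset.mul_sum, hφ]
  refine Finset.sum_congr rfl fun b _ => ?_
  have h1 : restr Λ (c - s) = restr Λ c := by
    funext i; simp [restr, hs i i.2]
  have h2 : glue Λ (c - s) b = glue Λ c b - s := by
    funext i; by_cases h : i ∈ Λ <;> simp [glue, h, hs]
  rw [h1, h2]
  ring

end Sites

/-! ### Geometric and algebraic data -/

/-- An oriented simplicial complex of dimension at most `N` which is `L`-regular. The simplices are
finite nonempty sets of vertices. The linear order of the vertices only serves to describe
orientations: every simplex has a reference orientation given by the increasing ordering of its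
vertices, and `sign` tells whether the chosen orientation of the simplex is the reference one
(`1`) or the opposite one (`-1`). A vertex has a single orientation. -/
structure RegularComplex (V : Type*) [LinearOrder V] (N L : ℕ)
    extends AbstractSimplicialComplex V where
  card_le : ∀ s ∈ faces, s.card ≤ N + 1
  order_le : ∀ s ∈ faces, {z ∈ faces | s ⊆ z ∧ z.card = s.card + 1}.encard ≤ L
  sign : Finset V → ℤˣ
  sign_vertex : ∀ v, sign {v} = 1

/-- A chain complex `𝔾_• = (𝔾_j, ∂_j : 𝔾_j → 𝔾_{j-1})` of finite abelian groups with
`𝔾_j = 0` for `j < 0` and for `j > N`. -/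
structure AlgebraicData (N : ℕ) where
  cplx : ChainComplex AddCommGrpCat ℤ
  finite : ∀ j, Finite (cplx.X j)
  vanish : ∀ j : ℤ, j < 0 ∨ (N : ℤ) < j → Subsingleton (cplx.X j)

namespace AlgebraicData

variable {N : ℕ} (𝔾 : AlgebraicData N)

/-- The group `𝔾_j`. -/
abbrev grp (j : ℤ) : Type _ := 𝔾.cplx.X j

instance (j : ℤ) : Finite (𝔾.grp j) := 𝔾.finite j

instance (j : ℤ) : Fintype (𝔾.grp j) := Fintype.ofFinite _

/-- The dual group `𝔾^_j` of characters of `𝔾_j`, written additively. -/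
abbrev dual (j : ℤ) : Type _ := AddChar (𝔾.grp j) ℂ

/-- The differential `𝔾_i → 𝔾_j` (which is zero unless `i = j + 1`). -/
def d (i j : ℤ) : 𝔾.grp i →+ 𝔾.grp j := (𝔾.cplx.d i j).hom

/-- The dual differential `α ↦ α ∘ ∂`, from `𝔾^_j` to `𝔾^_i`. -/
def dHat (i j : ℤ) : 𝔾.dual j →+ 𝔾.dual i where
  toFun α := α.compAddMonoidHom (𝔾.d i j)
  map_zero' := rfl
  map_add' _ _ := rfl

end AlgebraicData

variable {V : Type*} [LinearOrder V] {N L : ℕ}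

namespace RegularComplex

variable (X : RegularComplex V N L)

/-- The simplices of the complex. -/
abbrev Simplex : Type _ := {s : Finset V // s ∈ X.faces}

variable {X}

/-- The dimension of a simplex. -/
def dim (x : X.Simplex) : ℤ := (x.1.card : ℤ) - 1

/-- The incidence number `ε_{x,y}`: if the vertices of `x` are `v_0 < ⋯ < v_n` and `y` is the face
of `x` obtained by removing `v_i`, it is `(-1)^i`, corrected by the signs of the orientations
of `x` and `y`. It is zero if `y` is not a face of `x` of codimension one. -/
def inc (x y : X.Simplex) : ℤ :=
  ∑ v ∈ x.1, if x.1.erase v = y.1 then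
    (X.sign x.1 : ℤ) * (X.sign y.1 : ℤ) * (-1) ^ (x.1.filter (· < v)).card else 0

theorem subset_of_inc_ne_zero {x y : X.Simplex} (h : inc x y ≠ 0) :
    y.1 ⊆ x.1 ∧ x.1.card = y.1.card + 1 := by
  obtain ⟨v, hv, hne⟩ := Finset.exists_ne_zero_of_sum_ne_zero h
  have he : x.1.erase v = y.1 := by
    by_contra hc
    simp [hc] at hne
  rw [← he]
  exact ⟨Finset.erase_subset _ _, (Finset.card_erase_add_one hv).symm⟩

theorem finite_faces (x : X.Simplex) : {y : X.Simplex | inc x y ≠ 0}.Finite := by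
  refine Set.Finite.subset (Set.Finite.preimage (f := Subtype.val)
    Subtype.val_injective.injOn (x.1.powerset.finite_toSet)) fun y hy => ?_
  simpa using (subset_of_inc_ne_zero hy).1

theorem finite_cofaces (x : X.Simplex) : {z : X.Simplex | inc z x ≠ 0}.Finite := by
  have h : {z ∈ X.faces | x.1 ⊆ z ∧ z.card = x.1.card + 1}.Finite :=
    Set.finite_of_encard_le_coe (X.order_le x.1 x.2)
  refine Set.Finite.subset (Set.Finite.preimage (f := Subtype.val)
    Subtype.val_injective.injOn h) fun z hz => ?_
  exact ⟨z.2, (subset_of_inc_ne_zero hz).1, (subset_of_inc_ne_zero hz).2⟩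

variable (X) in
/-- The `n`-simplices of the complex. -/
abbrev Cell (n : ℤ) : Type _ := {x : X.Simplex // dim x = n}

variable (X) in
/-- The free abelian group `C_n` on the (oriented) `n`-simplices. -/
abbrev Chain (n : ℤ) : Type _ := X.Cell n →₀ ℤ

/-- The homomorphism from `C_n` to an abelian group with given values on the `n`-simplices. -/
def liftChain {n : ℤ} {A : Type*} [AddCommGroup A] (f : X.Cell n → A) : X.Chain n →+ A :=
  Finsupp.liftAddHom fun x => (zmultiplesHom A) (f x)

@[simp] theorem liftChain_single {n : ℤ} {A : Type*} [AddCommGroup A] (f : X.Cell n → A)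
    (x : X.Cell n) : liftChain f (Finsupp.single x 1) = f x := by
  simp [liftChain]

theorem finite_support_bdry {n m : ℤ} (x : X.Cell n) :
    (Function.support fun y : X.Cell m => inc x.1 y.1).Finite :=
  (finite_faces x.1).preimage Subtype.val_injective.injOn

theorem finite_support_cobdry {n m : ℤ} (x : X.Cell n) :
    (Function.support fun z : X.Cell m => inc z.1 x.1).Finite :=
  (finite_cofaces x.1).preimage Subtype.val_injective.injOn

variable (X) in
/-- The boundary operator `x ↦ ∑_y ε_{x,y} y` from `C_n` to `C_m`, used for `m = n - 1`. -/
def bdry (n m : ℤ) : X.Chain n →+ X.Chain m :=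
  liftChain fun x => Finsupp.ofSupportFinite (fun y : X.Cell m => inc x.1 y.1)
    (finite_support_bdry x)

variable (X) in
/-- The coboundary operator `x ↦ ∑_z ε_{z,x} z` from `C_n` to `C_m`, used for `m = n + 1`. -/
def cobdry (n m : ℤ) : X.Chain n →+ X.Chain m :=
  liftChain fun x => Finsupp.ofSupportFinite (fun z : X.Cell m => inc z.1 x.1)
    (finite_support_cobdry x)

/-- The `n`-simplex `x` as a generator of `C_n`. -/
def gen {n : ℤ} (x : X.Cell n) : X.Chain n := Finsupp.single x 1

end RegularComplex

open RegularComplex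

/-! ### Configurations and representations -/

section Maps

variable (X : RegularComplex V N L) (𝔾 : AlgebraicData N)

/-- The pairs of degrees `(n, q)` with `q = n - p`. -/
abbrev Deg (p : ℤ) : Type := {i : ℤ × ℤ // i.2 + p = i.1}

/-- `Hom(C, 𝔾)^p`: families of homomorphisms `t_n : C_n → 𝔾_{n-p}`, indexed by the pairs
`(n, q)` with `q = n - p`. -/
abbrev UpMap (p : ℤ) : Type _ := ∀ i : Deg p, X.Chain i.1.1 →+ 𝔾.grp i.1.2

/-- `Hom(C, 𝔾)_p`: families of homomorphisms `γ_n : C_n → 𝔾^_{n-p}`, indexed by the pairs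
`(n, q)` with `q = n - p`. -/
abbrev DownMap (p : ℤ) : Type _ := ∀ i : Deg p, X.Chain i.1.1 →+ 𝔾.dual i.1.2

variable {X 𝔾}

/-- The component `t_n : C_n → 𝔾_q`, `q = n - p`. -/
abbrev UpMap.v {p : ℤ} (t : UpMap X 𝔾 p) (n q : ℤ) (h : q + p = n) : X.Chain n →+ 𝔾.grp q :=
  t ⟨(n, q), h⟩

/-- The component `γ_n : C_n → 𝔾^_q`, `q = n - p`. -/
abbrev DownMap.v {p : ℤ} (γ : DownMap X 𝔾 p) (n q : ℤ) (h : q + p = n) :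
    X.Chain n →+ 𝔾.dual q :=
  γ ⟨(n, q), h⟩

/-- The map `δ^p : Hom(C, 𝔾)^p → Hom(C, 𝔾)^{p+1}`,
`(δ^p t)_n = t_{n-1} ∘ ∂_n - (-1)^p ∂_{n-p} ∘ t_n`. -/
def coboundary (p p' : ℤ) (hp : p + 1 = p') (t : UpMap X 𝔾 p) : UpMap X 𝔾 p' :=
  fun i => (UpMap.v t (i.1.1 - 1) i.1.2 (by have := i.2; lia)).comp (X.bdry i.1.1 (i.1.1 - 1))
    - (p.negOnePow : ℤ) •
      (𝔾.d (i.1.2 + 1) i.1.2).comp (UpMap.v t i.1.1 (i.1.2 + 1) (by have := i.2; lia))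

/-- The map `δ_p : Hom(C, 𝔾)_p → Hom(C, 𝔾)_{p-1}`,
`(δ_p γ)_n = γ_{n+1} ∘ ∂^_{n+1} - (-1)^{p-1} ∂^_{n+1-p} ∘ γ_n`, which is dual to `δ^{p-1}`. -/
def boundary (p p' : ℤ) (hp : p' + 1 = p) (γ : DownMap X 𝔾 p) : DownMap X 𝔾 p' :=
  fun i => (DownMap.v γ (i.1.1 + 1) i.1.2 (by have := i.2; lia)).comp (X.cobdry i.1.1 (i.1.1 + 1))
    - (p'.negOnePow : ℤ) •
      (𝔾.dHat i.1.2 (i.1.2 - 1)).comp (DownMap.v γ i.1.1 (i.1.2 - 1) (by have := i.2; lia))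

/-- The support of an element of `Hom(C, 𝔾)^p`. -/
def UpMap.supp {p : ℤ} (t : UpMap X 𝔾 p) : Set X.Simplex :=
  {x | ∃ q h, UpMap.v t (dim x) q h (gen ⟨x, rfl⟩) ≠ 0}

/-- The support of an element of `Hom(C, 𝔾)_p`. -/
def DownMap.supp {p : ℤ} (γ : DownMap X 𝔾 p) : Set X.Simplex :=
  {x | ∃ q h, DownMap.v γ (dim x) q h (gen ⟨x, rfl⟩) ≠ 0}

variable (X 𝔾)

/-- `Hom₀(C, 𝔾)^p`: the compactly supported elements of `Hom(C, 𝔾)^p`. -/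
def UpMap₀ (p : ℤ) : AddSubgroup (UpMap X 𝔾 p) where
  carrier := {t | (UpMap.supp t).Finite}
  zero_mem' := by simp [UpMap.supp]
  add_mem' := by
    intro s t hs ht
    refine (hs.union ht).subset ?_
    rintro x ⟨q, h, hx⟩
    by_contra hc
    simp only [UpMap.supp, Set.mem_union, Set.mem_ofPred_eq, not_or, not_exists, not_not] at hc
    exact hx (by simp [hc.1 q h, hc.2 q h])
  neg_mem' := by
    intro t ht
    simpa [UpMap.supp] using ht

/-- `Hom₀(C, 𝔾)_p`: the compactly supported elements of `Hom(C, 𝔾)_p`. -/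
def DownMap₀ (p : ℤ) : AddSubgroup (DownMap X 𝔾 p) where
  carrier := {γ | (DownMap.supp γ).Finite}
  zero_mem' := by simp [DownMap.supp]
  add_mem' := by
    intro s t hs ht
    refine (hs.union ht).subset ?_
    rintro x ⟨q, h, hx⟩
    by_contra hc
    simp only [DownMap.supp, Set.mem_union, Set.mem_ofPred_eq, not_or, not_exists, not_not] at hc
    exact hx (by simp [hc.1 q h, hc.2 q h])
  neg_mem' := by
    intro t ht
    simpa [DownMap.supp] using ht

variable {X 𝔾}

theorem hom_bdry_eq_zero {n m : ℤ} {A : Type*} [AddCommGroup A] (f : X.Chain m →+ A)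
    (x : X.Cell n) (h : ∀ y : X.Cell m, inc x.1 y.1 ≠ 0 → f (gen y) = 0) :
    f (X.bdry n m (gen x)) = 0 := by
  rw [gen, bdry, liftChain_single]
  generalize hc : Finsupp.ofSupportFinite (fun y : X.Cell m => inc x.1 y.1)
    (finite_support_bdry x) = c
  rw [← Finsupp.sum_single c, Finsupp.sum, map_sum]
  refine Finset.sum_eq_zero fun y hy => ?_
  rw [← mul_one (c y), ← smul_eq_mul, ← Finsupp.smul_single, map_zsmul]
  have := h y (by simpa [← hc, Finsupp.ofSupportFinite] using hy)
  rw [gen] at this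
  rw [this, smul_zero]

theorem hom_cobdry_eq_zero {n m : ℤ} {A : Type*} [AddCommGroup A] (f : X.Chain m →+ A)
    (x : X.Cell n) (h : ∀ z : X.Cell m, inc z.1 x.1 ≠ 0 → f (gen z) = 0) :
    f (X.cobdry n m (gen x)) = 0 := by
  rw [gen, cobdry, liftChain_single]
  generalize hc : Finsupp.ofSupportFinite (fun z : X.Cell m => inc z.1 x.1)
    (finite_support_cobdry x) = c
  rw [← Finsupp.sum_single c, Finsupp.sum, map_sum]
  refine Finset.sum_eq_zero fun z hz => ?_
  rw [← mul_one (c z), ← smul_eq_mul, ← Finsupp.smul_single, map_zsmul]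
  have := h z (by simpa [← hc, Finsupp.ofSupportFinite] using hz)
  rw [gen] at this
  rw [this, smul_zero]

theorem UpMap.eq_zero_of_notMem {p : ℤ} {t : UpMap X 𝔾 p} {x : X.Simplex}
    (hx : x ∉ UpMap.supp t) {n q : ℤ} (hn : dim x = n) (h : q + p = n) :
    UpMap.v t n q h (gen ⟨x, hn⟩) = 0 := by
  subst hn
  by_contra hc
  exact hx ⟨q, h, hc⟩

theorem DownMap.eq_zero_of_notMem {p : ℤ} {t : DownMap X 𝔾 p} {x : X.Simplex}
    (hx : x ∉ DownMap.supp t) {n q : ℤ} (hn : dim x = n) (h : q + p = n) :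
    DownMap.v t n q h (gen ⟨x, hn⟩) = 0 := by
  subst hn
  by_contra hc
  exact hx ⟨q, h, hc⟩

theorem supp_coboundary {p p' : ℤ} (hp : p + 1 = p') (t : UpMap X 𝔾 p) :
    UpMap.supp (coboundary p p' hp t) ⊆
      UpMap.supp t ∪ ⋃ y ∈ UpMap.supp t, {z | inc z y ≠ 0} := by
  rintro x ⟨q, h, hx⟩
  by_contra hc
  simp only [Set.mem_union, Set.mem_iUnion, Set.mem_ofPred_eq, not_or, not_exists, not_not] at hc
  refine hx ?_
  change _ - (p.negOnePow : ℤ) • 𝔾.d (q + 1) q (UpMap.v t (dim x) (q + 1) _ _) = 0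
  rw [UpMap.eq_zero_of_notMem hc.1, map_zero, smul_zero, sub_zero]
  refine hom_bdry_eq_zero _ _ fun y hy => ?_
  refine UpMap.eq_zero_of_notMem (x := y.1) (fun hy' => ?_) y.2 _
  exact hy (hc.2 y.1 hy')

theorem supp_boundary {p p' : ℤ} (hp : p' + 1 = p) (γ : DownMap X 𝔾 p) :
    DownMap.supp (boundary p p' hp γ) ⊆
      DownMap.supp γ ∪ ⋃ y ∈ DownMap.supp γ, {z | inc y z ≠ 0} := by
  rintro x ⟨q, h, hx⟩
  by_contra hc
  simp only [Set.mem_union, Set.mem_iUnion, Set.mem_ofPred_eq, not_or, not_exists, not_not] at hc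
  refine hx ?_
  change _ - (p'.negOnePow : ℤ) • 𝔾.dHat q (q - 1) (DownMap.v γ (dim x) (q - 1) _ _) = 0
  rw [DownMap.eq_zero_of_notMem hc.1, map_zero, zsmul_zero, sub_zero]
  refine hom_cobdry_eq_zero _ _ fun y hy => ?_
  refine DownMap.eq_zero_of_notMem (x := y.1) (fun hy' => ?_) y.2 _
  exact hy (hc.2 y.1 hy')

/-- The map `δ^p` on compactly supported elements. -/
def coboundary₀ (p p' : ℤ) (hp : p + 1 = p') (t : UpMap₀ X 𝔾 p) : UpMap₀ X 𝔾 p' :=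
  ⟨coboundary p p' hp t, (t.2.union (t.2.biUnion fun y _ => finite_cofaces y)).subset
    (supp_coboundary hp _)⟩

/-- The map `δ_p` on compactly supported elements. -/
def boundary₀ (p p' : ℤ) (hp : p' + 1 = p) (γ : DownMap₀ X 𝔾 p) : DownMap₀ X 𝔾 p' :=
  ⟨boundary p p' hp γ, (γ.2.union (γ.2.biUnion fun y _ => finite_faces y)).subset
    (supp_boundary hp _)⟩

open Classical in
/-- The localized map `x^*_g`, with value `g` at `x` and `0` at the other simplices. -/
def locUp {p q₀ : ℤ} (x : X.Simplex) (hx : q₀ + p = dim x) (g : 𝔾.grp q₀) : UpMap X 𝔾 p :=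
  fun i => liftChain fun y =>
    if hy : y.1 = x then (show q₀ = i.1.2 by have := y.2; have := i.2; rw [hy] at *; lia) ▸ g else 0

open Classical in
/-- The localized map `x_*^α`, with value `α` at `x` and `0` at the other simplices. -/
def locDown {p q₀ : ℤ} (x : X.Simplex) (hx : q₀ + p = dim x) (α : 𝔾.dual q₀) :
    DownMap X 𝔾 p :=
  fun i => liftChain fun y =>
    if hy : y.1 = x then (show q₀ = i.1.2 by have := y.2; have := i.2; rw [hy] at *; lia) ▸ α else 0

theorem supp_locUp {p q₀ : ℤ} (x : X.Simplex) (hx : q₀ + p = dim x) (g : 𝔾.grp q₀) :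
    UpMap.supp (locUp x hx g) ⊆ {x} := by
  rintro y ⟨q, h, hy⟩
  by_contra hc
  exact hy (by simp only [locUp, gen, liftChain_single]; exact dif_neg hc)

theorem supp_locDown {p q₀ : ℤ} (x : X.Simplex) (hx : q₀ + p = dim x) (α : 𝔾.dual q₀) :
    DownMap.supp (locDown x hx α) ⊆ {x} := by
  rintro y ⟨q, h, hy⟩
  by_contra hc
  exact hy (by simp only [locDown, gen, liftChain_single]; exact dif_neg hc)

/-- The localized map `x^*_g` as a compactly supported one. -/
def locUp₀ {p q₀ : ℤ} (x : X.Simplex) (hx : q₀ + p = dim x) (g : 𝔾.grp q₀) : UpMap₀ X 𝔾 p :=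
  ⟨locUp x hx g, (Set.finite_singleton x).subset (supp_locUp x hx g)⟩

/-- The localized map `x_*^α` as a compactly supported one. -/
def locDown₀ {p q₀ : ℤ} (x : X.Simplex) (hx : q₀ + p = dim x) (α : 𝔾.dual q₀) :
    DownMap₀ X 𝔾 p :=
  ⟨locDown x hx α, (Set.finite_singleton x).subset (supp_locDown x hx α)⟩

end Maps

/-! ### The operators of the model -/

section Model

variable (X : RegularComplex V N L) (𝔾 : AlgebraicData N)

/-- The group of labels of the site `x`: it is `𝔾_n` for an `n`-simplex `x`. -/
abbrev Site (x : X.Simplex) : Type _ := 𝔾.grp (dim x)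

/-- The quasi-local algebra `𝔄` of the model. -/
abbrev Alg : Type _ := quasiLocal (Site X 𝔾)

variable {X 𝔾}

/-- The value `t(x) ∈ 𝔾_n` of a `0`-map at an `n`-simplex `x`. -/
def upValue (t : UpMap X 𝔾 0) : Conf (Site X 𝔾) :=
  fun x => UpMap.v t (dim x) (dim x) (add_zero _) (gen ⟨x, rfl⟩)

/-- The value `γ(x) ∈ 𝔾^_n` of a dual `0`-map at an `n`-simplex `x`. -/
def downValue (γ : DownMap X 𝔾 0) (x : X.Simplex) : 𝔾.dual (dim x) :=
  DownMap.v γ (dim x) (dim x) (add_zero _) (gen ⟨x, rfl⟩)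

/-- The phase `γ(c) = ∏_x γ(x)[c(x)]`. -/
def phase (γ : DownMap X 𝔾 0) (c : Conf (Site X 𝔾)) : ℂ := ∏ᶠ x, downValue γ x (c x)

theorem norm_phase_le (γ : DownMap X 𝔾 0) : ∃ C, ∀ c, ‖phase γ c‖ ≤ C := by
  refine ⟨1, fun c => ?_⟩
  unfold phase
  by_cases h : (Function.mulSupport fun x => downValue γ x (c x)).Finite
  · rw [finprod_eq_prod _ h, norm_prod]
    exact (Finset.prod_eq_one fun x _ => AddChar.norm_apply _ _).le
  · rw [finprod_of_infinite_mulSupport h, norm_one]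

theorem shift_mem (t : UpMap₀ X 𝔾 0) {Λ : Finset X.Simplex} (h : UpMap.supp t.1 ⊆ Λ) :
    shift (upValue t.1) ∈ localAlg Λ := by
  refine mulShift_mem (fun _ _ _ => rfl) fun x hx => ?_
  exact UpMap.eq_zero_of_notMem (fun hx' => hx (h hx')) rfl _

theorem downValue_eq_zero {γ : DownMap X 𝔾 0} {x : X.Simplex} (hx : x ∉ DownMap.supp γ) :
    downValue γ x = 0 := DownMap.eq_zero_of_notMem hx rfl _

theorem phase_congr {γ : DownMap X 𝔾 0} {c c' : Conf (Site X 𝔾)}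
    (h : ∀ x ∈ DownMap.supp γ, c x = c' x) : phase γ c = phase γ c' := by
  refine finprod_congr fun x => ?_
  by_cases hx : x ∈ DownMap.supp γ
  · rw [h x hx]
  · simp [downValue_eq_zero hx]

theorem diag_mem (γ : DownMap₀ X 𝔾 0) {Λ : Finset X.Simplex} (h : DownMap.supp γ.1 ⊆ Λ) :
    diag (phase γ.1) ∈ localAlg Λ := by
  refine mulShift_mem (fun c c' hc => phase_congr fun x hx => ?_) fun x _ => rfl
  exact congrFun hc ⟨x, h hx⟩

/-- The shift operator `P_t : |c⟩ ↦ |c + t⟩`. -/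
def opP (t : UpMap₀ X 𝔾 0) : Alg X 𝔾 :=
  ⟨shift (upValue t.1), localAlg_le (Set.Finite.toFinset t.2) (shift_mem t (Set.Finite.coe_toFinset t.2).ge)⟩

/-- The clock operator `Q_γ : |c⟩ ↦ γ(c) |c⟩`. -/
def opQ (γ : DownMap₀ X 𝔾 0) : Alg X 𝔾 :=
  ⟨diag (phase γ.1), localAlg_le (Set.Finite.toFinset γ.2) (diag_mem γ (Set.Finite.coe_toFinset γ.2).ge)⟩

/-- `A_t = P_{δ^{-1} t}`. -/
def opA (t : UpMap₀ X 𝔾 (-1)) : Alg X 𝔾 := opP (coboundary₀ (-1) 0 (by norm_num) t)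

/-- `B_γ = Q_{δ_1 γ}`. -/
def opB (γ : DownMap₀ X 𝔾 1) : Alg X 𝔾 := opQ (boundary₀ 1 0 (by norm_num) γ)

variable (𝔾) in
/-- The star operator `A_x^0 = |𝔾_{n+1}|⁻¹ ∑_{g ∈ 𝔾_{n+1}} A_{x^*_g}` of an `n`-simplex `x`. -/
def starOp (x : X.Simplex) : Alg X 𝔾 :=
  (Fintype.card (𝔾.grp (dim x + 1)) : ℂ)⁻¹ •
    ∑ g : 𝔾.grp (dim x + 1), opA (locUp₀ x (add_neg_cancel_right _ _) g)

variable (𝔾) in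
/-- The plaquette operator `B_x^0 = |𝔾_{n-1}|⁻¹ ∑_{α ∈ 𝔾^_{n-1}} B_{x_*^α}` of an `n`-simplex
`x`. -/
def plaqOp (x : X.Simplex) : Alg X 𝔾 :=
  (Fintype.card (𝔾.grp (dim x - 1)) : ℂ)⁻¹ •
    ∑ α : 𝔾.dual (dim x - 1), opB (locDown₀ x (sub_add_cancel _ _) α)

/-- The support of `A_x^0`: the simplex `x` and its coboundary. -/
def starSupp (x : X.Simplex) : Set X.Simplex := {x} ∪ {z | inc z x ≠ 0}

/-- The support of `B_x^0`: the simplex `x` and its boundary. -/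
def plaqSupp (x : X.Simplex) : Set X.Simplex := {x} ∪ {y | inc x y ≠ 0}

variable (X 𝔾) in
open Classical in
/-- The local Hamiltonian `H^Λ = -(∑ A_x^0 + ∑ B_y^0)`, over the `x` and `y` such that the support
of `A_x^0`, respectively of `B_y^0`, is contained in `Λ`. -/
def hamiltonian (Λ : Finset X.Simplex) : Alg X 𝔾 :=
  -(∑ x ∈ Λ with starSupp x ⊆ (Λ : Set X.Simplex), starOp 𝔾 x
    + ∑ y ∈ Λ with plaqSupp y ⊆ (Λ : Set X.Simplex), plaqOp 𝔾 y)

/-- Membership in `𝔄_loc`. -/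
def IsLocal (A : Alg X 𝔾) : Prop := (A : Hilb (Site X 𝔾) →L[ℂ] Hilb (Site X 𝔾)) ∈ locAlg _

/-- The derivation `δ(A) = i [H^Λ, A]` on `𝔄_loc`, where `Λ` is any sufficiently large finite set of
simplices (the right-hand side is eventually constant, see `derivation_eq`). -/
def derivation (A : Alg X 𝔾) : Alg X 𝔾 :=
  Filter.limUnder Filter.atTop fun Λ : Finset X.Simplex => Complex.I • (hamiltonian X 𝔾 Λ * A - A * hamiltonian X 𝔾 Λ)

theorem starOp_commute {x : X.Simplex} {Λ : Finset X.Simplex} {A : Alg X 𝔾}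
    (hA : A.1 ∈ localAlg Λ) (h : ∀ y ∈ Λ, y ∉ starSupp x) : Commute (starOp 𝔾 x) A := by
  refine Commute.smul_left (Commute.sum_left _ _ _ fun g _ => ?_) _
  refine Subtype.ext ?_
  refine commute_of_disjoint hA (φ := fun _ => 1) ⟨1, by simp⟩ (fun _ _ => rfl) fun y hy => ?_
  refine UpMap.eq_zero_of_notMem (fun hy' => h y hy ?_) rfl _
  rcases supp_coboundary (by norm_num) _ hy' with h' | h'
  · exact Or.inl (supp_locUp _ (add_neg_cancel_right _ _) _ h')
  · simp only [Set.mem_iUnion] at h'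
    obtain ⟨w, hw, hw'⟩ := h'
    rw [Set.mem_singleton_iff.1 (supp_locUp _ (add_neg_cancel_right _ _) _ hw)] at hw'
    exact Or.inr hw'

theorem plaqOp_commute {x : X.Simplex} {Λ : Finset X.Simplex} {A : Alg X 𝔾}
    (hA : A.1 ∈ localAlg Λ) (h : ∀ y ∈ Λ, y ∉ plaqSupp x) : Commute (plaqOp 𝔾 x) A := by
  refine Commute.smul_left (Commute.sum_left _ _ _ fun g _ => ?_) _
  refine Subtype.ext ?_
  refine commute_of_disjoint hA (norm_phase_le _) (fun c a => phase_congr fun y hy' => ?_)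
    fun _ _ => rfl
  have : y ∉ Λ := fun hy => h y hy <| by
    rcases supp_boundary (by norm_num) _ hy' with h' | h'
    · exact Or.inl (supp_locDown _ (sub_add_cancel _ _) _ h')
    · simp only [Set.mem_iUnion] at h'
      obtain ⟨w, hw, hw'⟩ := h'
      rw [Set.mem_singleton_iff.1 (supp_locDown _ (sub_add_cancel _ _) _ hw)] at hw'
      exact Or.inr hw'
  simp [glue, this]

theorem eventually_commutator_eq {A : Alg X 𝔾} (hA : IsLocal A) :
    ∃ D : Alg X 𝔾, ∀ᶠ Λ in Filter.atTop, Complex.I • (hamiltonian X 𝔾 Λ * A - A * hamiltonian X 𝔾 Λ) = D := by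
  classical
  obtain ⟨Λ₀, hΛ₀⟩ := mem_locAlg.1 hA
  -- the terms whose support meets `Λ₀`
  have hS : {x : X.Simplex | ∃ y ∈ Λ₀, y ∈ starSupp x}.Finite := by
    refine (Set.Finite.biUnion Λ₀.finite_toSet (fun y _ =>
      (Set.finite_singleton y).union (finite_faces y))).subset ?_
    rintro x ⟨y, hy, hy'⟩
    simp only [Set.mem_iUnion]
    refine ⟨y, hy, ?_⟩
    rcases hy' with h | h
    · exact Or.inl h.symm
    · exact Or.inr h
  have hP : {x : X.Simplex | ∃ y ∈ Λ₀, y ∈ plaqSupp x}.Finite := by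
    refine (Set.Finite.biUnion Λ₀.finite_toSet (fun y _ =>
      (Set.finite_singleton y).union (finite_cofaces y))).subset ?_
    rintro x ⟨y, hy, hy'⟩
    simp only [Set.mem_iUnion]
    refine ⟨y, hy, ?_⟩
    rcases hy' with h | h
    · exact Or.inl h.symm
    · exact Or.inr h
  have hF : (⋃ x ∈ hS.toFinset, starSupp x).Finite :=
    Set.Finite.biUnion (Finset.finite_toSet _) fun x _ =>
      (Set.finite_singleton x).union (finite_cofaces x)
  have hF' : (⋃ x ∈ hP.toFinset, plaqSupp x).Finite :=
    Set.Finite.biUnion (Finset.finite_toSet _) fun x _ =>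
      (Set.finite_singleton x).union (finite_faces x)
  refine ⟨Complex.I • -(∑ x ∈ hS.toFinset, (starOp 𝔾 x * A - A * starOp 𝔾 x) +
    ∑ x ∈ hP.toFinset, (plaqOp 𝔾 x * A - A * plaqOp 𝔾 x)), ?_⟩
  filter_upwards [Filter.eventually_ge_atTop (hF.toFinset ∪ hF'.toFinset)] with Λ hΛ
  rw [hamiltonian, neg_mul, mul_neg, add_mul, mul_add, ← neg_sub', add_sub_add_comm,
    Finset.sum_mul, Finset.mul_sum, Finset.sum_mul, Finset.mul_sum, ← Finset.sum_sub_distrib,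
    ← Finset.sum_sub_distrib]
  congr 3
  · symm
    refine Finset.sum_subset (fun x hx => ?_) fun x _ hx => ?_
    · have hsub : starSupp x ⊆ (Λ : Set X.Simplex) := fun z hz =>
        hΛ (Finset.mem_union_left _ (hF.mem_toFinset.2 (Set.mem_biUnion hx hz)))
      exact Finset.mem_filter.2 ⟨hsub (Or.inl rfl), hsub⟩
    · refine sub_eq_zero.2 (starOp_commute hΛ₀ ?_).eq
      exact fun y hy hy' => hx (hS.mem_toFinset.2 ⟨y, hy, hy'⟩)
  · symm
    refine Finset.sum_subset (fun x hx => ?_) fun x _ hx => ?_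
    · have hsub : plaqSupp x ⊆ (Λ : Set X.Simplex) := fun z hz =>
        hΛ (Finset.mem_union_right _ (hF'.mem_toFinset.2 (Set.mem_biUnion hx hz)))
      exact Finset.mem_filter.2 ⟨hsub (Or.inl rfl), hsub⟩
    · refine sub_eq_zero.2 (plaqOp_commute hΛ₀ ?_).eq
      exact fun y hy hy' => hx (hP.mem_toFinset.2 ⟨y, hy, hy'⟩)

theorem derivation_eq {A : Alg X 𝔾} (hA : IsLocal A) :
    ∀ᶠ Λ in Filter.atTop, derivation A = Complex.I • (hamiltonian X 𝔾 Λ * A - A * hamiltonian X 𝔾 Λ) := by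
  obtain ⟨D, hD⟩ := eventually_commutator_eq hA
  have : derivation A = D :=
    (tendsto_const_nhds.congr' (hD.mono fun _ h => h.symm)).limUnder_eq
  exact hD.mono fun Λ h => this.trans h.symm

end Model

/-! ### States -/

section States

variable {𝔅 : Type*} [Ring 𝔅] [StarRing 𝔅] [Algebra ℂ 𝔅]

/-- A state: a positive linear functional `ω` with `ω 1 = 1`. -/
def IsState (ω : 𝔅 →ₗ[ℂ] ℂ) : Prop := (∀ A, 0 ≤ ω (star A * A)) ∧ ω 1 = 1

/-- A pure state: an extreme point of the set of states. -/
def IsPureState (ω : 𝔅 →ₗ[ℂ] ℂ) : Prop :=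
  ω ∈ Set.extremePoints ℝ {ω' : 𝔅 →ₗ[ℂ] ℂ | IsState ω'}

variable {X : RegularComplex V N L} {𝔾 : AlgebraicData N}

/-- A ground state of the model: `-i ω(A* δ(A)) ≥ 0` for all `A ∈ 𝔄_loc`. -/
def IsGroundState (ω : Alg X 𝔾 →ₗ[ℂ] ℂ) : Prop :=
  IsState ω ∧ ∀ A : Alg X 𝔾, IsLocal A → 0 ≤ -Complex.I * ω (star A * derivation A)

/-- A frustration-free ground state: a ground state with `ω(A_x^0) = ω(B_y^0) = 1` for all `x`,
`y`. -/
def IsFrustrationFree (ω : Alg X 𝔾 →ₗ[ℂ] ℂ) : Prop :=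
  IsGroundState ω ∧ ∀ x y : X.Simplex, ω (starOp 𝔾 x) = 1 ∧ ω (plaqOp 𝔾 y) = 1

variable (X 𝔾) in
/-- The core algebra `𝔎`: the C*-subalgebra of `𝔄` generated by the operators `A_t` and `B_γ`. -/
def core : StarSubalgebra ℂ (Alg X 𝔾) :=
  (StarAlgebra.adjoin ℂ (Set.range (opA (X := X) (𝔾 := 𝔾)) ∪ Set.range opB)).topologicalClosure

theorem opA_mem_core (t : UpMap₀ X 𝔾 (-1)) : opA t ∈ core X 𝔾 :=
  StarSubalgebra.le_topologicalClosure _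
    (StarAlgebra.subset_adjoin ℂ _ (Or.inl ⟨t, rfl⟩))

theorem opB_mem_core (γ : DownMap₀ X 𝔾 1) : opB γ ∈ core X 𝔾 :=
  StarSubalgebra.le_topologicalClosure _
    (StarAlgebra.subset_adjoin ℂ _ (Or.inr ⟨γ, rfl⟩))

/-- The monomial `A_t B_γ` as an element of the core algebra. -/
def coreMonomial (t : UpMap₀ X 𝔾 (-1)) (γ : DownMap₀ X 𝔾 1) : core X 𝔾 :=
  ⟨opA t * opB γ, mul_mem (opA_mem_core t) (opB_mem_core γ)⟩

/-- The defining property of the seed state `ϑ`: it is a state of the core algebra such that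
`ϑ(A_t B_γ) = 1` for all `t` and `γ`. -/
def IsSeedState (ϑ : core X 𝔾 →ₗ[ℂ] ℂ) : Prop :=
  IsState ϑ ∧ ∀ t γ, ϑ (coreMonomial t γ) = 1

/-- The restriction of a functional on `𝔄` to the core algebra. -/
def restrictCore (ω : Alg X 𝔾 →ₗ[ℂ] ℂ) : core X 𝔾 →ₗ[ℂ] ℂ :=
  ω ∘ₗ (core X 𝔾).subtype.toAlgHom.toLinearMap

end States

end QDM

end

/-!
The operators `A_t` and `B_γ` are two unitary representations of discrete abelian groups. They
commute: `B_γ A_t = ⟨δ_1 γ, δ^{-1} t⟩ A_t B_γ`, and the phase is `⟨γ, δ^0 δ^{-1} t⟩ = 1` because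
`δ_1` is dual to `δ^0` (`phase_boundary_locDown`) and `δ^0 δ^{-1} = 0` (`coboundary_coboundary`,
which rests on `∂ ∂ = 0` for the simplicial boundary). Hence the monomials `A_t B_γ` form a group of
unitaries whose linear span is dense in the core algebra, and, states being norm continuous, a state
of the core algebra is determined by its values on the monomials (`core_state_ext`). A state takes
values in the unit disc on unitaries, and `1` is an extreme point of the disc; this makes the seed
state pure (`IsSeedState.isPureState`).

The star and plaquette operators are averages of the `A_t` and `B_γ` over localized `t` and `γ`, and
localized maps generate all the compactly supported ones. If a state has expectation `1` on such an
average, then it has expectation `1` on every unitary that enters it, again by extremality; and the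
unitaries with expectation `1` fix the cyclic vector of the state (`IsState.map_mul_unitary`), so
that they form a group. Thus the conditions `ω(A_x^0) = ω(B_y^0) = 1` are equivalent to
`ω(A_t B_γ) = 1` for all `t` and `γ`. The ground state inequality is then automatic, since `-H^Λ` is
a sum of projections, each of which has expectation `1` (`isGroundState_of_eq_one`).

For existence, only finitely many `t` are considered first. The configurations `δ^{-1} t` generate a
finite group, because the group of configurations has finite exponent, and the indicator function of
this finite group is a vector fixed by the given `A_t` and by all `B_γ`
(`exists_isState_of_finset`). The states that satisfy all the conditions `ω(A_t B_γ) = 1` therefore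
form a nonempty compact face of the state space, and any extreme point of this face, provided by the
Krein–Milman theorem, is a pure state (`exists_isPureState_of_finite`).
-/

noncomputable section

namespace QDM

open RegularComplex

/-! ### States of a unital C*-algebra -/

section AbstractStates

variable {𝔅 : Type*} [CStarAlgebra 𝔅] {ω : 𝔅 →ₗ[ℂ] ℂ}

theorem IsState.map_star (hω : IsState ω) (A : 𝔅) : ω (star A) = star (ω A) := by
  -- `ω` takes real values on `(A + 1)* (A + 1)` and on `(A + i)* (A + i)`
  have h0 := (Complex.nonneg_iff.1 (hω.1 A)).2
  have h1 := (Complex.nonneg_iff.1 (hω.1 (A + 1))).2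
  have h2 := (Complex.nonneg_iff.1 (hω.1 (A + Complex.I • (1 : 𝔅)))).2
  have e1 : star (A + 1) * (A + 1) = star A * A + star A + A + 1 := by
    simp only [star_add, star_one]; noncomm_ring
  have e2 : star (A + Complex.I • (1 : 𝔅)) * (A + Complex.I • (1 : 𝔅)) =
      star A * A + Complex.I • star A - Complex.I • A + 1 := by
    simp only [star_add, star_smul, star_one, add_mul, mul_add, smul_mul_assoc, mul_smul_comm,
      one_mul, mul_one, smul_add, smul_smul]
    simp
    abel
  rw [e1, map_add, map_add, map_add, hω.2] at h1
  rw [e2, map_add, map_sub, map_add, hω.2, map_smul, map_smul] at h2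
  simp only [Complex.add_im, Complex.sub_im, ← h0, Complex.one_im, smul_eq_mul, Complex.mul_im,
    Complex.I_re, Complex.I_im] at h1 h2
  apply Complex.ext
  · simp; linarith
  · simp; linarith

/-- The degenerate case of the Cauchy–Schwarz inequality. -/
theorem IsState.map_mul_eq_zero (hω : IsState ω) {C : 𝔅} (hC : ω (star C * C) = 0) (B : 𝔅) :
    ω (B * C) = 0 := by
  set w := ω (B * C) with hw
  have hw' : ω (star C * star B) = star w := by rw [← star_mul, hω.map_star]
  have key : ∀ r : ℝ, 0 ≤ (ω (B * star B)).re - 2 * r * Complex.normSq w := by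
    intro r
    have h := hω.1 (star B + (-(r : ℂ) * star w) • C)
    have e : star (star B + (-(r : ℂ) * star w) • C) * (star B + (-(r : ℂ) * star w) • C) =
        B * star B + (-(r : ℂ) * star w) • (B * C) + (-(r : ℂ) * w) • (star C * star B) +
          ((-(r : ℂ) * w) * (-(r : ℂ) * star w)) • (star C * C) := by
      simp only [star_add, star_smul, star_star, add_mul, mul_add, smul_mul_assoc, mul_smul_comm,
        smul_add, smul_smul, star_mul', star_neg]
      simp
      rw [mul_comm ((r : ℂ) * w)]
      abel
    rw [e] at h
    simp only [map_add, map_smul, hC, hw', ← hw, smul_eq_mul, mul_zero, add_zero] at h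
    have h' := (Complex.nonneg_iff.1 h).1
    simp [Complex.normSq_apply] at h' ⊢
    linarith
  by_contra hne
  have hpos := Complex.normSq_pos.2 hne
  have := key (((ω (B * star B)).re + 1) / (2 * Complex.normSq w))
  field_simp at this
  linarith

theorem IsState.norm_le (hω : IsState ω) (A : 𝔅) : ‖ω A‖ ≤ ‖A‖ := by
  have h1 : (ω (star A * A)).re ≤ ‖A‖ ^ 2 := by
    let := CStarAlgebra.spectralOrder 𝔅
    have := CStarAlgebra.spectralOrderedRing 𝔅
    have h := sub_nonneg.2 (CStarAlgebra.star_mul_le_algebraMap_norm_sq (a := A))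
    obtain ⟨C, hC⟩ := CStarAlgebra.nonneg_iff_eq_star_mul_self.1 h
    have h2 := hω.1 C
    rw [← hC, map_sub, Algebra.algebraMap_eq_smul_one] at h2
    have h3 : ω ((‖A‖ ^ 2) • (1 : 𝔅)) = ((‖A‖ ^ 2 : ℝ) : ℂ) := by
      rw [← Complex.coe_smul, map_smul, hω.2, smul_eq_mul, mul_one]
    rw [h3] at h2
    have := (Complex.nonneg_iff.1 h2).1
    rw [Complex.sub_re, Complex.ofReal_re] at this
    linarith
  have h2 : Complex.normSq (ω A) ≤ (ω (star A * A)).re := by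
    have h := hω.1 (A - ω A • (1 : 𝔅))
    have e : star (A - ω A • (1 : 𝔅)) * (A - ω A • (1 : 𝔅)) =
        star A * A - ω A • star A - star (ω A) • A + (star (ω A) * ω A) • (1 : 𝔅) := by
      simp only [star_sub, star_smul, star_one, sub_mul, mul_sub, smul_mul_assoc, mul_smul_comm,
        one_mul, mul_one, smul_sub, smul_smul]
      rw [mul_comm (ω A)]
      abel
    rw [e] at h
    simp only [map_add, map_sub, map_smul, hω.2, hω.map_star, smul_eq_mul] at h
    have h' := (Complex.nonneg_iff.1 h).1
    simp [Complex.normSq_apply] at h' ⊢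
    linarith
  refine abs_le_of_sq_le_sq' ?_ (norm_nonneg _) |>.2
  rw [← Complex.normSq_eq_norm_sq]
  exact h2.trans h1

theorem IsState.continuous (hω : IsState ω) : Continuous ω :=
  AddMonoidHomClass.continuous_of_bound ω 1 fun A => by simpa using hω.norm_le A

theorem IsState.norm_unitary_le (hω : IsState ω) {U : 𝔅} (hU : star U * U = 1) : ‖ω U‖ ≤ 1 := by
  refine (hω.norm_le U).trans ?_
  have h := CStarRing.norm_star_mul_self (x := U)
  rw [hU] at h
  rcases subsingleton_or_nontrivial 𝔅 with h' | h'
  · rw [Subsingleton.elim U 0]; simp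
  · rw [CStarRing.norm_one] at h
    nlinarith [norm_nonneg U]

/-- A unitary `U` with `ω U = 1` acts trivially on the cyclic vector of `ω`, because
`ω ((U - 1)* (U - 1)) = 2 - 2 Re (ω U) = 0`. -/
theorem IsState.map_mul_unitary (hω : IsState ω) {U : 𝔅} (hU : star U * U = 1) (h1 : ω U = 1)
    (B : 𝔅) : ω (B * U) = ω B := by
  have h : ω (star (U - 1) * (U - 1)) = 0 := by
    have e : star (U - 1) * (U - 1) = star U * U - star U - U + 1 := by
      simp only [star_sub, star_one]; noncomm_ring
    rw [e, hU, map_add, map_sub, map_sub, hω.map_star, h1, hω.2]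
    simp
  have := hω.map_mul_eq_zero h B
  rwa [mul_sub, mul_one, map_sub, sub_eq_zero] at this

theorem eq_one_of_re_eq_one {z : ℂ} (hz : ‖z‖ ≤ 1) (hre : z.re = 1) : z = 1 := by
  have him : z.im = 0 := by
    have h2 : ‖z‖ ^ 2 ≤ 1 := by nlinarith [norm_nonneg z]
    rw [← Complex.normSq_eq_norm_sq, Complex.normSq_apply, hre] at h2
    nlinarith
  exact Complex.ext (by simpa using hre) (by simpa using him)

/-- `1` is an extreme point of the unit disc. -/
theorem eq_one_of_convex_combination {a b : ℝ} (ha : 0 < a) (hb : 0 < b) (hab : a + b = 1)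
    {z w : ℂ} (hz : ‖z‖ ≤ 1) (hw : ‖w‖ ≤ 1) (h : a • z + b • w = 1) : z = 1 := by
  have h1 := congrArg Complex.re h
  simp at h1
  have hzr := (Complex.re_le_norm z).trans hz
  have hwr := (Complex.re_le_norm w).trans hw
  exact eq_one_of_re_eq_one hz (by nlinarith)

/-- If an average of unitaries has expectation `1`, then so has each of them: `1` is an extreme
point of the unit disc. -/
theorem IsState.map_eq_one_of_average (hω : IsState ω) {κ : Type*} [Fintype κ] {n : ℕ}
    (hn : Fintype.card κ = n) (U : κ → 𝔅) (hU : ∀ k, star (U k) * U k = 1)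
    (h : ω ((n : ℂ)⁻¹ • ∑ k, U k) = 1) (k : κ) : ω (U k) = 1 := by
  subst hn
  have hn : (Fintype.card κ : ℂ) ≠ 0 := by
    have : Nonempty κ := ⟨k⟩
    exact_mod_cast Fintype.card_ne_zero
  have hle : ∀ k, (ω (U k)).re ≤ 1 := fun k =>
    (Complex.re_le_norm _).trans (hω.norm_unitary_le (hU k))
  have hsum : ∑ k, (1 - (ω (U k)).re) = 0 := by
    rw [map_smul, map_sum, smul_eq_mul, inv_mul_eq_iff_eq_mul₀ hn, mul_one] at h
    have := congrArg Complex.re h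
    rw [Complex.re_sum, Complex.natCast_re] at this
    rw [Finset.sum_sub_distrib, this]
    simp
  have hre : (ω (U k)).re = 1 := by
    have := (Finset.sum_eq_zero_iff_of_nonneg fun k _ => sub_nonneg.2 (hle k)).1 hsum k
      (Finset.mem_univ k)
    linarith
  exact eq_one_of_re_eq_one (hω.norm_unitary_le (hU k)) hre

theorem IsState.map_average_eq_one {κ : Type*} [Fintype κ] [Nonempty κ] {n : ℕ}
    (hn : Fintype.card κ = n) (U : κ → 𝔅) (h : ∀ k, ω (U k) = 1) :
    ω ((n : ℂ)⁻¹ • ∑ k, U k) = 1 := by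
  subst hn
  simp [h]

/-- The contribution to the ground state inequality of a projection that has expectation `1`. -/
theorem IsState.projection_inequality (hω : IsState ω) {P : 𝔅} (hs : star P = P) (hi : P * P = P)
    (h1 : ω P = 1) (A : 𝔅) : 0 ≤ ω (star A * A * P) - ω (star A * P * A) := by
  have hC : star (1 - P) * (1 - P) = 1 - P := by
    rw [star_sub, star_one, hs, sub_mul, mul_sub, mul_sub, hi]; simp
  have h0 : ω (star (1 - P) * (1 - P)) = 0 := by rw [hC, map_sub, hω.2, h1, sub_self]
  have h2 : ω (star A * A * P) = ω (star A * A) := by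
    have := hω.map_mul_eq_zero h0 (star A * A)
    rw [mul_sub, mul_one, map_sub, sub_eq_zero] at this
    exact this.symm
  have h3 := hω.1 ((1 - P) * A)
  have e : star ((1 - P) * A) * ((1 - P) * A) = star A * A - star A * P * A := by
    rw [star_mul, mul_assoc, ← mul_assoc (star (1 - P)), hC, sub_mul, mul_sub, one_mul, mul_assoc]
  rwa [e, map_sub, ← h2] at h3

section Average

variable {κ : Type*} [AddCommGroup κ] [Fintype κ] {n : ℕ} {U : κ → 𝔅}

theorem star_average (hstar : ∀ g, star (U g) = U (-g)) :
    star ((n : ℂ)⁻¹ • ∑ g, U g) = (n : ℂ)⁻¹ • ∑ g, U g := by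
  rw [star_smul, star_sum]
  simp only [hstar]
  rw [Fintype.sum_equiv (Equiv.neg κ) (fun g => U (-g)) U fun _ => rfl]
  simp

/-- The average of a unitary representation of a finite group is idempotent. -/
theorem average_mul_average (hn : Fintype.card κ = n) (hadd : ∀ g h, U (g + h) = U g * U h) :
    ((n : ℂ)⁻¹ • ∑ g, U g) * ((n : ℂ)⁻¹ • ∑ g, U g) = (n : ℂ)⁻¹ • ∑ g, U g := by
  subst hn
  have h : ∀ g, U g * ∑ h, U h = ∑ h, U h := fun g => by
    rw [Finset.mul_sum]
    simp only [← hadd]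
    exact Equiv.sum_comp (Equiv.addLeft g) U
  rw [smul_mul_smul_comm, Finset.sum_mul]
  simp only [h, Finset.sum_const, Finset.card_univ]
  rw [← Nat.cast_smul_eq_nsmul ℂ, smul_smul]
  congr 1
  field_simp

end Average

/-! ### Compactness of the state space -/

/-- If finitely many of the conditions `ω (U k) = 1` can always be satisfied by a state, then all of
them are satisfied by some pure state: the states that satisfy them form a face of the state space,
which is compact for pointwise convergence, and the Krein–Milman theorem applies to this face. -/
theorem exists_isPureState_of_finite {κ : Type*} {U : κ → 𝔅} (hU : ∀ k, star (U k) * U k = 1)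
    (h : ∀ s : Finset κ, ∃ ω : 𝔅 →ₗ[ℂ] ℂ, IsState ω ∧ ∀ k ∈ s, ω (U k) = 1) :
    ∃ ω : 𝔅 →ₗ[ℂ] ℂ, IsPureState ω ∧ ∀ k, ω (U k) = 1 := by
  let K : Set κ → Set (𝔅 → ℂ) := fun s =>
    {f | ∃ ω : 𝔅 →ₗ[ℂ] ℂ, (IsState ω ∧ ∀ k ∈ s, ω (U k) = 1) ∧ ⇑ω = f}
  have hclosed : ∀ s, IsClosed (K s) := by
    intro s
    have hK : K s = {f | (∀ a b, f (a + b) = f a + f b) ∧ (∀ (r : ℂ) a, f (r • a) = r * f a) ∧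
        (∀ a, 0 ≤ (f (star a * a)).re ∧ 0 = (f (star a * a)).im) ∧ f 1 = 1 ∧
        ∀ k ∈ s, f (U k) = 1} := by
      ext f
      constructor
      · rintro ⟨ω, ⟨h1, h2⟩, rfl⟩
        exact ⟨map_add ω, map_smul ω, fun a => Complex.nonneg_iff.1 (h1.1 a), h1.2, h2⟩
      · rintro ⟨h1, h2, h3, h4, h5⟩
        exact ⟨{ toFun := f, map_add' := h1, map_smul' := h2 },
          ⟨⟨fun a => Complex.nonneg_iff.2 (h3 a), h4⟩, h5⟩, rfl⟩
    rw [hK]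
    simp only [Set.ofPred_and, Set.ofPred_forall]
    refine IsClosed.inter (isClosed_iInter fun a => isClosed_iInter fun b => ?_)
      (IsClosed.inter (isClosed_iInter fun r => isClosed_iInter fun a => ?_)
      (IsClosed.inter (isClosed_iInter fun a => IsClosed.inter ?_ ?_)
      (IsClosed.inter ?_ (isClosed_iInter fun k => isClosed_iInter fun _ => ?_))))
    · exact isClosed_eq (by fun_prop) (by fun_prop)
    · exact isClosed_eq (by fun_prop) (by fun_prop)
    · exact isClosed_le (by fun_prop) (by fun_prop)
    · exact isClosed_eq (by fun_prop) (by fun_prop)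
    · exact isClosed_eq (by fun_prop) (by fun_prop)
    · exact isClosed_eq (by fun_prop) (by fun_prop)
  have hcompact : ∀ s, IsCompact (K s) := fun s =>
    (isCompact_univ_pi fun a : 𝔅 => isCompact_closedBall (0 : ℂ) ‖a‖).of_isClosed_subset
      (hclosed s) (by
        rintro f ⟨ω, ⟨h1, -⟩, rfl⟩ a -
        simpa using h1.norm_le a)
  have hne : (K Set.univ).Nonempty := by
    have hmono : ∀ {s s' : Set κ}, s ⊆ s' → K s' ⊆ K s := by
      rintro s s' hs f ⟨ω, ⟨h1, h2⟩, rfl⟩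
      exact ⟨ω, ⟨h1, fun k hk => h2 k (hs hk)⟩, rfl⟩
    have hdir : Directed (· ⊇ ·) fun s : Finset κ => K s := by
      classical
      exact fun s s' => ⟨s ∪ s', hmono (by simp), hmono (by simp)⟩
    obtain ⟨f, hf⟩ := IsCompact.nonempty_iInter_of_directed_nonempty_isCompact_isClosed
      (fun s : Finset κ => K s) hdir
      (fun s => by
        obtain ⟨ω, h1, h2⟩ := h s
        exact ⟨ω, ω, ⟨h1, h2⟩, rfl⟩)
      (fun s => hcompact _) (fun s => hclosed _)
    rw [Set.mem_iInter] at hf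
    obtain ⟨ω, ⟨h1, -⟩, rfl⟩ := hf ∅
    refine ⟨ω, ω, ⟨h1, fun k _ => ?_⟩, rfl⟩
    obtain ⟨ω', ⟨-, h2⟩, hω'⟩ := hf {k}
    rw [← hω']
    exact h2 k (by simp)
  obtain ⟨f, ⟨ω, ⟨h1, h2⟩, rfl⟩, hext⟩ := (hcompact Set.univ).extremePoints_nonempty hne
  refine ⟨ω, ⟨h1, fun ω₁ hω₁ ω₂ hω₂ hseg => ?_⟩, fun k => h2 k (Set.mem_univ k)⟩
  obtain ⟨a, b, ha, hb, hab, rfl⟩ := hseg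
  -- both components take the value `1` at each `U k`, because `1` is extreme in the unit disc
  have hω₁U : ∀ k, ω₁ (U k) = 1 := fun k =>
    eq_one_of_convex_combination ha hb hab (IsState.norm_unitary_le hω₁ (hU k))
      (IsState.norm_unitary_le hω₂ (hU k)) (h2 k (Set.mem_univ k))
  have hω₂U : ∀ k, ω₂ (U k) = 1 := fun k =>
    eq_one_of_convex_combination hb ha (by rwa [add_comm]) (IsState.norm_unitary_le hω₂ (hU k))
      (IsState.norm_unitary_le hω₁ (hU k)) ((add_comm _ _).trans (h2 k (Set.mem_univ k)))
  exact DFunLike.coe_injective (hext ⟨ω₁, ⟨hω₁, fun k _ => hω₁U k⟩, rfl⟩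
    ⟨ω₂, ⟨hω₂, fun k _ => hω₂U k⟩, rfl⟩ ⟨a, b, ha, hb, hab, rfl⟩)

end AbstractStates

/-! ### The identities `∂ ∂ = 0` and `δ δ = 0` -/

section Complexes

variable {V : Type*} [LinearOrder V] {N L : ℕ} {X : RegularComplex V N L} {𝔾 : AlgebraicData N}

theorem bdry_gen_apply {n m : ℤ} (x : X.Cell n) (y : X.Cell m) :
    X.bdry n m (gen x) y = inc x.1 y.1 := by
  rw [gen, bdry, liftChain_single]; rfl

theorem cobdry_gen_apply {n m : ℤ} (x : X.Cell n) (y : X.Cell m) :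
    X.cobdry n m (gen x) y = inc y.1 x.1 := by
  rw [gen, cobdry, liftChain_single]; rfl

theorem liftChain_apply {n : ℤ} {A : Type*} [AddCommGroup A] (f : X.Chain n →+ A) (c : X.Chain n) :
    f c = ∑ᶠ y, c y • f (gen y) := by
  have : ∀ y, c y • f (gen y) = f (Finsupp.single y (c y)) := fun y => by
    rw [← map_zsmul, gen, Finsupp.smul_single, smul_eq_mul, mul_one]
  rw [finsum_eq_sum_of_support_subset (s := c.support)]
  · conv_lhs => rw [← Finsupp.sum_single c, Finsupp.sum, map_sum]
    exact Finset.sum_congr rfl fun y _ => (this y).symm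
  · intro y hy
    by_contra hc
    exact hy (by simp [Finsupp.notMem_support_iff.1 hc])

/-- Two elements of a set can be removed in either order, with opposite signs. -/
theorem removal_sign_of_lt {x : Finset V} {v w : V} (hv : v ∈ x) (h : v < w) :
    (-1 : ℤ) ^ (x.filter (· < v)).card * (-1) ^ ((x.erase v).filter (· < w)).card =
      -((-1) ^ (x.filter (· < w)).card * (-1) ^ ((x.erase w).filter (· < v)).card) := by
  have h1 : (x.erase w).filter (· < v) = x.filter (· < v) := by
    rw [Finset.filter_erase]
    exact Finset.erase_eq_of_notMem fun hw => lt_asymm h (Finset.mem_filter.1 hw).2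
  have h2 : ((x.erase v).filter (· < w)).card + 1 = (x.filter (· < w)).card := by
    rw [Finset.filter_erase]
    exact Finset.card_erase_add_one (Finset.mem_filter.2 ⟨hv, h⟩)
  rw [h1, ← h2, pow_succ]
  ring

theorem removal_sign {x : Finset V} {v w : V} (hv : v ∈ x) (hw : w ∈ x) (h : v ≠ w) :
    (-1 : ℤ) ^ (x.filter (· < v)).card * (-1) ^ ((x.erase v).filter (· < w)).card =
      -((-1) ^ (x.filter (· < w)).card * (-1) ^ ((x.erase w).filter (· < v)).card) := by
  rcases lt_or_gt_of_ne h with h | h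
  · exact removal_sign_of_lt hv h
  · rw [removal_sign_of_lt hw h, neg_neg]

/-- The removals of two vertices that lead from `x` to `z` cancel in pairs. -/
theorem sum_removal_sign (x z : Finset V) :
    ∑ v ∈ x, (-1 : ℤ) ^ (x.filter (· < v)).card *
      ∑ w ∈ x.erase v, (if (x.erase v).erase w = z then
        (-1) ^ ((x.erase v).filter (· < w)).card else 0) = 0 := by
  let g : V → V → ℤ := fun v w => if v ≠ w ∧ (x.erase v).erase w = z then
    (-1) ^ (x.filter (· < v)).card * (-1) ^ ((x.erase v).filter (· < w)).card else 0
  have hg : ∀ v ∈ x, ∀ w ∈ x, g v w = -g w v := by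
    intro v hv w hw
    simp only [g, ne_comm (a := w) (b := v), Finset.erase_right_comm (a := w) (b := v)]
    split_ifs with h
    · exact removal_sign hv hw h.1
    · simp
  have hS : ∑ v ∈ x, ∑ w ∈ x, g v w = -∑ v ∈ x, ∑ w ∈ x, g v w := by
    conv_rhs => rw [Finset.sum_comm]
    simp only [← Finset.sum_neg_distrib]
    exact Finset.sum_congr rfl fun v hv => Finset.sum_congr rfl fun w hw => hg v hv w hw
  have h0 : ∑ v ∈ x, ∑ w ∈ x, g v w = 0 := by lia
  refine Eq.trans (Finset.sum_congr rfl fun v hv => ?_) h0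
  have hvv : g v v = 0 := by simp [g]
  rw [← Finset.sum_erase x hvv, Finset.mul_sum]
  refine Finset.sum_congr rfl fun w hw => ?_
  simp only [g, mul_ite, mul_zero]
  exact if_congr (by simp [(Finset.ne_of_mem_erase hw).symm]) rfl rfl

/-- The coefficient of `z` in `∂ ∂ x` vanishes. -/
theorem sum_inc_mul_inc {n m : ℤ} (hm : m + 1 = n) (x : X.Cell n) (z : X.Simplex) :
    ∑ᶠ y : X.Cell m, inc x.1 y.1 * inc y.1 z = 0 := by
  classical
  -- a face of `x` that has `z` as a face is nonempty, hence a simplex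
  by_cases hz : ∃ v ∈ x.1.1, z.1 ⊆ x.1.1.erase v
  swap
  · refine finsum_eq_zero_of_forall_eq_zero fun y => ?_
    by_contra h
    obtain ⟨v, hv, hne⟩ := Finset.exists_ne_zero_of_sum_ne_zero (left_ne_zero_of_mul h)
    have he : x.1.1.erase v = y.1.1 := by
      by_contra hc
      simp [hc] at hne
    exact hz ⟨v, hv, he ▸ (subset_of_inc_ne_zero (right_ne_zero_of_mul h)).1⟩
  obtain ⟨v₀, hv₀, hzv⟩ := hz
  have hne : ∀ v ∈ x.1.1, (x.1.1.erase v).Nonempty := by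
    intro v hv
    have h0 : 0 < (x.1.1.erase v₀).card :=
      Finset.card_pos.2 ((X.isRelLowerSet_faces z.2).1.mono hzv)
    rw [Finset.card_erase_of_mem hv₀] at h0
    rw [← Finset.card_pos, Finset.card_erase_of_mem hv]
    exact h0
  let face : x.1.1 → X.Cell m := fun v =>
    ⟨⟨x.1.1.erase v, (X.isRelLowerSet_faces x.1.2).2 (Finset.erase_subset _ _) (hne v v.2)⟩, by
      have h1 := x.2
      have h2 := Finset.card_erase_add_one v.2
      simp only [dim] at h1 ⊢
      lia⟩
  have hface : ∀ (v : x.1.1) (y : X.Cell m), x.1.1.erase v = y.1.1 ↔ y = face v := fun v y =>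
    ⟨fun h => Subtype.ext (Subtype.ext h.symm), fun h => by rw [h]⟩
  have hinc : ∀ y : X.Cell m, inc x.1 y.1 = ∑ v : x.1.1, if y = face v then
      (X.sign x.1.1 : ℤ) * (X.sign y.1.1 : ℤ) * (-1) ^ (x.1.1.filter (· < v.1)).card else 0 := by
    intro y
    rw [inc, ← Finset.sum_coe_sort]
    simp only [hface]
  rw [finsum_eq_sum_of_support_subset (s := Finset.univ.image face)]
  swap
  · intro y hy
    have h := left_ne_zero_of_mul hy
    rw [hinc] at h
    obtain ⟨v, -, hv⟩ := Finset.exists_ne_zero_of_sum_ne_zero h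
    have : y = face v := by
      by_contra hc
      simp [hc] at hv
    simp [this]
  simp only [hinc, Finset.sum_mul]
  rw [Finset.sum_comm]
  have key : ∀ v : x.1.1, ∑ y ∈ Finset.univ.image face, (if y = face v then
      (X.sign x.1.1 : ℤ) * (X.sign y.1.1 : ℤ) * (-1) ^ (x.1.1.filter (· < v.1)).card else 0) *
        inc y.1 z = (X.sign x.1.1 : ℤ) * (X.sign z.1 : ℤ) *
          ((-1 : ℤ) ^ (x.1.1.filter (· < v.1)).card * ∑ w ∈ x.1.1.erase v,
            (if (x.1.1.erase v).erase w = z.1 then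
              (-1) ^ ((x.1.1.erase v).filter (· < w)).card else 0)) := by
    intro v
    rw [Finset.sum_eq_single (face v) (fun y _ hy => by simp [hy])
      (fun h => absurd (Finset.mem_image_of_mem face (Finset.mem_univ v)) h), if_pos rfl, inc]
    simp only [Finset.mul_sum, mul_ite, mul_zero]
    refine Finset.sum_congr rfl fun w _ => if_congr Iff.rfl ?_ rfl
    have hs : (X.sign (face v).1.1 : ℤ) * (X.sign (face v).1.1 : ℤ) = 1 :=
      Int.units_coe_mul_self _
    change _ * (-1) ^ (x.1.1.filter (· < v.1)).card *
      (_ * _ * (-1) ^ ((x.1.1.erase v).filter (· < w)).card) = _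
    linear_combination ((X.sign x.1.1 : ℤ) * (-1) ^ (x.1.1.filter (· < v.1)).card *
      (X.sign z.1 : ℤ) * (-1) ^ ((x.1.1.erase v).filter (· < w)).card) * hs
  simp only [key]
  rw [← Finset.mul_sum, Finset.sum_coe_sort x.1.1 fun v =>
    (-1 : ℤ) ^ (x.1.1.filter (· < v)).card * ∑ w ∈ x.1.1.erase v,
      (if (x.1.1.erase v).erase w = z.1 then
        (-1) ^ ((x.1.1.erase v).filter (· < w)).card else 0), sum_removal_sign, mul_zero]

/-- `∂ ∂ = 0`. -/
theorem bdry_bdry {n m k : ℤ} (hm : m + 1 = n) (c : X.Chain n) :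
    X.bdry m k (X.bdry n m c) = 0 := by
  have : (X.bdry m k).comp (X.bdry n m) = 0 := by
    refine Finsupp.addHom_ext' fun x => AddMonoidHom.ext_int ?_
    change X.bdry m k (X.bdry n m (gen x)) = 0
    ext z
    have h := liftChain_apply ((Finsupp.applyAddHom z).comp (X.bdry m k)) (X.bdry n m (gen x))
    simp only [AddMonoidHom.comp_apply, Finsupp.applyAddHom_apply, bdry_gen_apply,
      smul_eq_mul] at h
    rw [h, sum_inc_mul_inc hm x z.1, Finsupp.zero_apply]
  exact DFunLike.congr_fun this c

theorem AlgebraicData.d_d (i j k : ℤ) (g : 𝔾.grp i) : 𝔾.d j k (𝔾.d i j g) = 0 := by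
  have := 𝔾.cplx.d_comp_d i j k
  exact DFunLike.congr_fun (congrArg AddCommGrpCat.Hom.hom this) g

/-- `δ^0 δ^{-1} = 0`. -/
theorem coboundary_coboundary (t : UpMap X 𝔾 (-1)) :
    coboundary 0 1 (by norm_num) (coboundary (-1) 0 (by norm_num) t) = 0 := by
  funext i
  refine AddMonoidHom.ext fun c => ?_
  simp [coboundary, AlgebraicData.d_d, bdry_bdry]

end Complexes

section Pairing

variable {V : Type*} [LinearOrder V] {N L : ℕ} {X : RegularComplex V N L} {𝔾 : AlgebraicData N}

/-! ### Localized maps generate the compactly supported ones -/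

theorem locUp_apply {p q n : ℤ} (x : X.Simplex) (hx : q + p = dim x) (g : 𝔾.grp q)
    (hn : dim x = n) (h : q + p = n) (y : X.Cell n) :
    locUp x hx g ⟨(n, q), h⟩ (gen y) = if y = ⟨x, hn⟩ then g else 0 := by
  simp only [locUp, gen, liftChain_single]
  by_cases hy : y.1 = x
  · rw [dif_pos hy, if_pos (Subtype.ext hy)]
  · rw [dif_neg hy, if_neg fun h => hy (congrArg Subtype.val h)]

theorem locDown_apply {p q n : ℤ} (x : X.Simplex) (hx : q + p = dim x) (α : 𝔾.dual q)
    (hn : dim x = n) (h : q + p = n) (y : X.Cell n) :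
    locDown x hx α ⟨(n, q), h⟩ (gen y) = if y = ⟨x, hn⟩ then α else 0 := by
  simp only [locDown, gen, liftChain_single]
  by_cases hy : y.1 = x
  · rw [dif_pos hy, if_pos (Subtype.ext hy)]
  · rw [dif_neg hy, if_neg fun h => hy (congrArg Subtype.val h)]

theorem eq_sum_locUp₀ {p : ℤ} (t : UpMap₀ X 𝔾 p) :
    t = ∑ x ∈ Set.Finite.toFinset t.2, locUp₀ x (sub_add_cancel (dim x) p)
      (UpMap.v t.1 (dim x) (dim x - p) (sub_add_cancel _ _) (gen ⟨x, rfl⟩)) := by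
  refine Subtype.ext (funext fun ⟨⟨n, q⟩, h⟩ => Finsupp.addHom_ext' fun ⟨y, hy⟩ =>
    AddMonoidHom.ext_int ?_)
  change t.1 ⟨(n, q), h⟩ (gen ⟨y, hy⟩) = _
  rw [AddSubgroup.val_finsetSum, Finset.sum_apply]
  change _ = (∑ x ∈ Set.Finite.toFinset t.2, _ : X.Chain n →+ 𝔾.grp q) (gen ⟨y, hy⟩)
  rw [AddMonoidHom.finsetSum_apply]
  obtain rfl : dim y = n := hy
  obtain rfl : q = dim y - p := eq_sub_of_add_eq h
  rw [Finset.sum_eq_single y]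
  · exact ((locUp_apply y (sub_add_cancel _ _) _ rfl h ⟨y, rfl⟩).trans (if_pos rfl)).symm
  · intro x _ hxy
    simp only [locUp₀, locUp, gen, liftChain_single]
    exact dif_neg hxy.symm
  · intro hy
    simp only [locUp₀, locUp, gen, liftChain_single, dite_true]
    exact UpMap.eq_zero_of_notMem (fun h' => hy ((Set.Finite.mem_toFinset _).2 h')) rfl h

theorem eq_sum_locDown₀ {p : ℤ} (γ : DownMap₀ X 𝔾 p) :
    γ = ∑ x ∈ Set.Finite.toFinset γ.2, locDown₀ x (sub_add_cancel (dim x) p)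
      (DownMap.v γ.1 (dim x) (dim x - p) (sub_add_cancel _ _) (gen ⟨x, rfl⟩)) := by
  refine Subtype.ext (funext fun ⟨⟨n, q⟩, h⟩ => Finsupp.addHom_ext' fun ⟨y, hy⟩ =>
    AddMonoidHom.ext_int ?_)
  change γ.1 ⟨(n, q), h⟩ (gen ⟨y, hy⟩) = _
  rw [AddSubgroup.val_finsetSum, Finset.sum_apply]
  change _ = (∑ x ∈ Set.Finite.toFinset γ.2, _ : X.Chain n →+ 𝔾.dual q) (gen ⟨y, hy⟩)
  rw [AddMonoidHom.finsetSum_apply]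
  obtain rfl : dim y = n := hy
  obtain rfl : q = dim y - p := eq_sub_of_add_eq h
  rw [Finset.sum_eq_single y]
  · exact ((locDown_apply y (sub_add_cancel _ _) _ rfl h ⟨y, rfl⟩).trans (if_pos rfl)).symm
  · intro x _ hxy
    simp only [locDown₀, locDown, gen, liftChain_single]
    exact dif_neg hxy.symm
  · intro hy
    simp only [locDown₀, locDown, gen, liftChain_single, dite_true]
    exact DownMap.eq_zero_of_notMem (fun h' => hy ((Set.Finite.mem_toFinset _).2 h')) rfl h

/-- A subgroup that contains the localized maps is everything. -/
theorem mem_of_locUp₀_mem {p : ℤ} {S : AddSubgroup (UpMap₀ X 𝔾 p)}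
    (h : ∀ (x : X.Simplex) (q : ℤ) (hx : q + p = dim x) (g : 𝔾.grp q), locUp₀ x hx g ∈ S)
    (t : UpMap₀ X 𝔾 p) : t ∈ S := by
  rw [eq_sum_locUp₀ t]
  exact sum_mem fun x _ => h x _ _ _

theorem mem_of_locDown₀_mem {p : ℤ} {S : AddSubgroup (DownMap₀ X 𝔾 p)}
    (h : ∀ (x : X.Simplex) (q : ℤ) (hx : q + p = dim x) (α : 𝔾.dual q), locDown₀ x hx α ∈ S)
    (γ : DownMap₀ X 𝔾 p) : γ ∈ S := by
  rw [eq_sum_locDown₀ γ]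
  exact sum_mem fun x _ => h x _ _ _

/-! ### The pairing of configurations and dual configurations -/

theorem coboundary₀_add {p p' : ℤ} (hp : p + 1 = p') (s t : UpMap₀ X 𝔾 p) :
    coboundary₀ p p' hp (s + t) = coboundary₀ p p' hp s + coboundary₀ p p' hp t := by
  refine Subtype.ext (funext fun i => AddMonoidHom.ext fun c => ?_)
  simp [coboundary₀, coboundary, smul_add]
  abel

theorem boundary₀_add {p p' : ℤ} (hp : p' + 1 = p) (γ η : DownMap₀ X 𝔾 p) :
    boundary₀ p p' hp (γ + η) = boundary₀ p p' hp γ + boundary₀ p p' hp η := by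
  refine Subtype.ext (funext fun i => AddMonoidHom.ext fun c => ?_)
  simp [boundary₀, boundary, zsmul_add]
  abel

theorem upValue_add (s t : UpMap X 𝔾 0) : upValue (s + t) = upValue s + upValue t := rfl

theorem finite_mulSupport_downValue (γ : DownMap₀ X 𝔾 0) (c : Conf (Site X 𝔾)) :
    (Function.mulSupport fun x => downValue γ.1 x (c x)).Finite :=
  γ.2.subset fun x hx => by
    by_contra h
    exact hx (by simp [downValue_eq_zero h])

theorem phase_add_left (γ η : DownMap₀ X 𝔾 0) (c : Conf (Site X 𝔾)) :
    phase (γ + η).1 c = phase γ.1 c * phase η.1 c := by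
  rw [phase, phase, phase, ← finprod_mul_distrib (finite_mulSupport_downValue γ c)
    (finite_mulSupport_downValue η c)]
  rfl

theorem phase_add_right (γ : DownMap₀ X 𝔾 0) (c c' : Conf (Site X 𝔾)) :
    phase γ.1 (c + c') = phase γ.1 c * phase γ.1 c' := by
  rw [phase, phase, phase, ← finprod_mul_distrib (finite_mulSupport_downValue γ c)
    (finite_mulSupport_downValue γ c')]
  exact finprod_congr fun x => AddChar.map_add_eq_mul _ _ _

theorem phase_zero_left (c : Conf (Site X 𝔾)) : phase (0 : DownMap X 𝔾 0) c = 1 :=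
  finprod_eq_one_of_forall_eq_one fun _ => rfl

theorem phase_zero_right (γ : DownMap X 𝔾 0) : phase γ 0 = 1 :=
  finprod_eq_one_of_forall_eq_one fun _ => AddChar.map_zero_eq_one _

theorem addChar_map_sum {A κ : Type*} [AddCommGroup A] (α : AddChar A ℂ) (s : Finset κ)
    (f : κ → A) : α (∑ k ∈ s, f k) = ∏ k ∈ s, α (f k) := by
  classical
  induction s using Finset.induction_on with
  | empty => simp
  | insert k s hk ih => rw [Finset.sum_insert hk, Finset.prod_insert hk, α.map_add_eq_mul, ih]

theorem hom_locDown {p q n : ℤ} (x : X.Simplex) (hx : q + p = dim x) (α : 𝔾.dual q)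
    (hn : dim x = n) (h : q + p = n) (c : X.Chain n) :
    locDown x hx α ⟨(n, q), h⟩ c = c ⟨x, hn⟩ • α := by
  rw [liftChain_apply, finsum_eq_single _ ⟨x, hn⟩]
  · rw [locDown_apply x hx α hn h, if_pos rfl]
  · intro y hy
    rw [locDown_apply x hx α hn h, if_neg hy]
    exact zsmul_zero _

theorem hom_locDown_of_ne {p q : ℤ} (x : X.Simplex) (hx : q + p = dim x) (α : 𝔾.dual q)
    {i : Deg p} (hn : dim x ≠ i.1.1) (c : X.Chain i.1.1) : locDown x hx α i c = 0 := by
  rw [liftChain_apply]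
  refine finsum_eq_zero_of_forall_eq_zero fun y => ?_
  rw [locDown, gen, liftChain_single, dif_neg fun h : y.1 = x => hn (h ▸ y.2)]
  exact zsmul_zero _

theorem locDown_cobdry {q : ℤ} (x : X.Simplex) (hx : q + 1 = dim x) (α : 𝔾.dual q)
    (t : UpMap X 𝔾 0) {y : X.Simplex} (hy : dim y = q) :
    (locDown x hx α ⟨(dim y + 1, dim y), rfl⟩ (X.cobdry (dim y) (dim y + 1) (gen ⟨y, rfl⟩)))
      (upValue t y) = α (inc x y • t.v q q (add_zero _) (gen ⟨y, hy⟩)) := by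
  subst hy
  rw [hom_locDown x hx α hx.symm, cobdry_gen_apply, AddChar.map_zsmul_eq_zpow]
  exact AddChar.zsmul_apply _ _ _

/-- `δ_1` and `δ^0` are dual to each other, in the form in which `δ_1` is applied to the localized
map with value `α` at `x`. -/
theorem phase_boundary_locDown {q : ℤ} (x : X.Simplex) (hx : q + 1 = dim x) (α : 𝔾.dual q)
    (t : UpMap X 𝔾 0) :
    phase (boundary 1 0 (by norm_num) (locDown x hx α)) (upValue t) =
      α (coboundary 0 1 (by norm_num) t ⟨(dim x, q), hx⟩ (gen ⟨x, rfl⟩)) := by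
  obtain rfl : q = dim x - 1 := eq_sub_of_add_eq hx
  let a : X.Simplex → ℂ := fun y =>
    (locDown x hx α ⟨(dim y + 1, dim y), rfl⟩ (X.cobdry (dim y) (dim y + 1) (gen ⟨y, rfl⟩)))
      (upValue t y)
  let b : X.Simplex → ℂ := fun y =>
    ((locDown x hx α ⟨(dim y, dim y - 1), sub_add_cancel _ _⟩ (gen ⟨y, rfl⟩))
      (𝔾.d (dim y) (dim y - 1) (upValue t y)))⁻¹
  have ha1 : ∀ y : X.Simplex, dim y ≠ dim x - 1 → a y = 1 := by
    intro y hy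
    simp only [a]
    rw [hom_locDown_of_ne x hx α (i := ⟨(dim y + 1, dim y), rfl⟩)
      (fun h => hy (by simp only at h; lia)), AddChar.zero_apply]
  have ha2 : ∀ y : X.Cell (dim x - 1), a y.1 =
      α (inc x y.1 • t.v (dim x - 1) (dim x - 1) (add_zero _) (gen y)) := by
    rintro ⟨y, hy⟩
    exact locDown_cobdry x hx α t hy
  have hb1 : ∀ y, y ≠ x → b y = 1 := by
    intro y hy
    simp only [b, locDown, gen, liftChain_single]
    rw [dif_neg hy, AddChar.zero_apply, inv_one]
  have hb2 : b x = (α (𝔾.d (dim x) (dim x - 1) (upValue t x)))⁻¹ := by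
    simp only [b]
    rw [locDown_apply x hx α rfl hx, if_pos rfl]
  have hab : phase (boundary 1 0 (by norm_num) (locDown x hx α)) (upValue t) =
      ∏ᶠ y, a y * b y := by
    refine finprod_congr fun y => ?_
    simp [boundary, downValue, a, b, AddChar.sub_apply', div_eq_mul_inv]
    exact Or.inl rfl
  have hafin : (Function.mulSupport a).Finite := by
    refine (finite_faces x).subset fun y hy => ?_
    by_contra h
    by_cases hd : dim y = dim x - 1
    · refine hy ((ha2 ⟨y, hd⟩).trans ?_)
      simp only [Set.mem_ofPred_eq, not_not] at h
      rw [h, zero_smul, AddChar.map_zero_eq_one]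
    · exact hy (ha1 y hd)
  have hbfin : (Function.mulSupport b).Finite :=
    (Set.finite_singleton x).subset fun y hy => by
      by_contra h
      exact hy (hb1 y h)
  have hprod : ∏ᶠ y, a y = ∏ᶠ y : X.Cell (dim x - 1), a y.1 := by
    rw [finprod_subtype_eq_finprod_cond fun y : X.Simplex => dim y = dim x - 1]
    refine finprod_congr fun y => ?_
    by_cases hd : dim y = dim x - 1
    · simp [hd]
    · simp [hd, ha1 y hd]
  have hα : α (t.v (dim x - 1) (dim x - 1) (add_zero _)
      (X.bdry (dim x) (dim x - 1) (gen ⟨x, rfl⟩))) = ∏ᶠ y, a y := by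
    have hf := finite_support_bdry (m := dim x - 1) (⟨x, rfl⟩ : X.Cell (dim x))
    rw [hprod, liftChain_apply, finsum_eq_sum_of_support_subset (s := hf.toFinset),
      finprod_eq_prod_of_mulSupport_subset (s := hf.toFinset), addChar_map_sum]
    · exact Finset.prod_congr rfl fun y _ => by rw [ha2, bdry_gen_apply]
    · intro y hy
      by_contra h
      simp only [Set.Finite.coe_toFinset, Function.mem_support, not_not] at h
      exact hy (by beta_reduce; rw [ha2, h, zero_smul, AddChar.map_zero_eq_one])
    · intro y hy
      by_contra h
      simp only [Set.Finite.coe_toFinset, Function.mem_support, not_not] at h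
      exact hy (by beta_reduce; rw [bdry_gen_apply, h, zero_smul])
  have hd : ∀ (k : ℤ) (hk : k = dim x) (h : k + 0 = dim x),
      𝔾.d k (dim x - 1) (t.v (dim x) k h (gen ⟨x, rfl⟩)) =
        𝔾.d (dim x) (dim x - 1) (upValue t x) := by
    rintro k rfl h
    rfl
  rw [hab, finprod_mul_distrib hafin hbfin, finprod_eq_single b x hb1, hb2, ← hα,
    ← hd (dim x - 1 + 1) (sub_add_cancel _ _) (by lia), ← AddChar.map_neg_eq_inv,
    ← AddChar.map_add_eq_mul, ← sub_eq_add_neg]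
  simp [coboundary]

/-- `⟨δ_1 γ, δ^{-1} t⟩ = 1`: this is the dual form of `δ^0 δ^{-1} = 0`. -/
theorem phase_boundary_coboundary (γ : DownMap₀ X 𝔾 1) (t : UpMap X 𝔾 (-1)) :
    phase (boundary₀ 1 0 (by norm_num) γ).1 (upValue (coboundary (-1) 0 (by norm_num) t)) = 1 := by
  let φ : DownMap₀ X 𝔾 1 →+ Additive ℂ :=
    { toFun := fun γ => Additive.ofMul (phase (boundary₀ 1 0 (by norm_num) γ).1
        (upValue (coboundary (-1) 0 (by norm_num) t)))
      map_zero' := by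
        have h : boundary₀ 1 0 (by norm_num) (0 : DownMap₀ X 𝔾 1) = 0 := by
          simpa using boundary₀_add (p' := 0) (by norm_num) (0 : DownMap₀ X 𝔾 1) 0
        rw [h]
        exact phase_zero_left _
      map_add' := fun γ η => by
        rw [boundary₀_add, phase_add_left]
        rfl }
  refine mem_of_locDown₀_mem (S := φ.ker) (fun x q hx α => ?_) γ
  change phase (boundary 1 0 (by norm_num) (locDown x hx α)) _ = 1
  rw [phase_boundary_locDown, coboundary_coboundary]
  exact AddChar.map_zero_eq_one _

end Pairing

section Closed

variable {V : Type*} [LinearOrder V] {N L : ℕ} (X : RegularComplex V N L) (𝔾 : AlgebraicData N)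

theorem isClosed_quasiLocal : IsClosed
    (quasiLocal (Site X 𝔾) : Set (Hilb (Site X 𝔾) →L[ℂ] Hilb (Site X 𝔾))) :=
  StarSubalgebra.isClosed_topologicalClosure _

theorem isClosed_core : IsClosed (core X 𝔾 : Set (Alg X 𝔾)) :=
  StarSubalgebra.isClosed_topologicalClosure _

end Closed

-- closed *-subalgebras are C*-algebras, so that the results on abstract states apply
attribute [local instance] isClosed_quasiLocal isClosed_core

section Core

variable {V : Type*} [LinearOrder V] {N L : ℕ} {X : RegularComplex V N L} {𝔾 : AlgebraicData N}

/-! ### The commuting unitary representations `A` and `B` -/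

theorem opA_apply (t : UpMap₀ X 𝔾 (-1)) (f : Hilb (Site X 𝔾)) (c : Conf (Site X 𝔾)) :
    (opA t).1 f c = f (c - upValue (coboundary (-1) 0 (by norm_num) t.1)) :=
  shift_apply _ _ _

theorem opB_apply (γ : DownMap₀ X 𝔾 1) (f : Hilb (Site X 𝔾)) (c : Conf (Site X 𝔾)) :
    (opB γ).1 f c = phase (boundary₀ 1 0 (by norm_num) γ).1 c * f c :=
  diag_apply (norm_phase_le _) _ _

theorem opA_add (s t : UpMap₀ X 𝔾 (-1)) : opA (s + t) = opA s * opA t := by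
  refine Subtype.ext ?_
  ext f c
  change _ = (opA s).1 ((opA t).1 f) c
  rw [opA_apply, opA_apply, opA_apply, sub_sub, ← upValue_add]
  exact congrArg (fun d => f (c - upValue (Subtype.val d)))
    (coboundary₀_add (p' := 0) (by norm_num) s t)

theorem opB_add (γ η : DownMap₀ X 𝔾 1) : opB (γ + η) = opB γ * opB η := by
  refine Subtype.ext ?_
  ext f c
  change _ = (opB γ).1 ((opB η).1 f) c
  rw [opB_apply, opB_apply, opB_apply, boundary₀_add, phase_add_left, mul_assoc]

theorem opA_zero : opA (0 : UpMap₀ X 𝔾 (-1)) = 1 := by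
  have h : coboundary₀ (-1) 0 (by norm_num) (0 : UpMap₀ X 𝔾 (-1)) = 0 := by
    simpa using coboundary₀_add (p' := 0) (by norm_num) (0 : UpMap₀ X 𝔾 (-1)) 0
  refine Subtype.ext ?_
  ext f c
  rw [opA_apply]
  change f (c - upValue (coboundary₀ (-1) 0 (by norm_num) (0 : UpMap₀ X 𝔾 (-1))).1) = f c
  rw [h]
  exact congrArg (fun d => f d) (sub_zero c)

theorem opB_zero : opB (0 : DownMap₀ X 𝔾 1) = 1 := by
  have h : boundary₀ 1 0 (by norm_num) (0 : DownMap₀ X 𝔾 1) = 0 := by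
    simpa using boundary₀_add (p' := 0) (by norm_num) (0 : DownMap₀ X 𝔾 1) 0
  refine Subtype.ext ?_
  ext f c
  rw [opB_apply, h]
  exact (congrArg (· * f c) (phase_zero_left c)).trans (one_mul _)

theorem star_opA (t : UpMap₀ X 𝔾 (-1)) : star (opA t) = opA (-t) := by
  have h := star_mulShift (φ := fun _ => 1) ⟨1, by simp⟩
    (upValue (coboundary (-1) 0 (by norm_num) t.1))
  refine Subtype.ext (h.trans ?_)
  ext f c
  rw [mulShift_apply ⟨1, by simp⟩, opA_apply, star_one, one_mul]
  refine congrArg (fun d => f (c - d)) (funext fun x => ?_)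
  simp [upValue, coboundary]
  abel

theorem star_phase (γ : DownMap₀ X 𝔾 0) (c : Conf (Site X 𝔾)) :
    star (phase γ.1 c) = phase (-γ).1 c := by
  have h := (starRingEnd ℂ).toMonoidHom.map_finprod (finite_mulSupport_downValue γ c)
  refine h.trans (finprod_congr fun x => ?_)
  exact (AddChar.map_neg_eq_conj _ _).symm

theorem star_opB (γ : DownMap₀ X 𝔾 1) : star (opB γ) = opB (-γ) := by
  have hn : boundary₀ 1 0 (by norm_num) (-γ) = -boundary₀ 1 0 (by norm_num) γ :=
    (AddMonoidHom.mk' _ (boundary₀_add (X := X) (𝔾 := 𝔾) (p := 1) (p' := 0)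
      (by norm_num))).map_neg γ
  have h := star_mulShift (norm_phase_le (boundary₀ 1 0 (by norm_num) γ).1) 0
  refine Subtype.ext (h.trans ?_)
  ext f c
  have hb : ∃ C, ∀ c : Conf (Site X 𝔾), ‖star (phase (boundary₀ 1 0 (by norm_num) γ).1 (c + 0))‖
      ≤ C := (norm_phase_le (boundary₀ 1 0 (by norm_num) γ).1).imp fun C hC c => by
    rw [norm_star]; exact hC _
  rw [mulShift_apply hb, opB_apply, hn, ← star_phase, add_zero]
  exact congrArg (fun d => _ * f d) (by rw [neg_zero, sub_zero])

theorem star_opA_mul_self (t : UpMap₀ X 𝔾 (-1)) : star (opA t) * opA t = 1 := by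
  rw [star_opA, ← opA_add, neg_add_cancel, opA_zero]

theorem star_opB_mul_self (γ : DownMap₀ X 𝔾 1) : star (opB γ) * opB γ = 1 := by
  rw [star_opB, ← opB_add, neg_add_cancel, opB_zero]

theorem opB_mul_opA (t : UpMap₀ X 𝔾 (-1)) (γ : DownMap₀ X 𝔾 1) :
    opB γ * opA t = opA t * opB γ := by
  refine Subtype.ext ?_
  ext f c
  change (opB γ).1 ((opA t).1 f) c = (opA t).1 ((opB γ).1 f) c
  rw [opA_apply, opB_apply, opB_apply, opA_apply]
  congr 1
  have h := phase_add_right (boundary₀ 1 0 (by norm_num) γ)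
    (c - upValue (coboundary (-1) 0 (by norm_num) t.1))
    (upValue (coboundary (-1) 0 (by norm_num) t.1))
  rwa [phase_boundary_coboundary, mul_one, sub_add_cancel] at h

theorem opA_mul_opB_mul (s t : UpMap₀ X 𝔾 (-1)) (γ η : DownMap₀ X 𝔾 1) :
    opA s * opB γ * (opA t * opB η) = opA (s + t) * opB (γ + η) := by
  rw [opA_add, opB_add, mul_assoc, ← mul_assoc (opB γ), opB_mul_opA]
  simp only [mul_assoc]

theorem star_opA_mul_opB (t : UpMap₀ X 𝔾 (-1)) (γ : DownMap₀ X 𝔾 1) :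
    star (opA t * opB γ) = opA (-t) * opB (-γ) := by
  rw [star_mul, star_opA, star_opB, opB_mul_opA]

theorem star_opA_mul_opB_mul_self (t : UpMap₀ X 𝔾 (-1)) (γ : DownMap₀ X 𝔾 1) :
    star (opA t * opB γ) * (opA t * opB γ) = 1 := by
  rw [star_opA_mul_opB, opA_mul_opB_mul, neg_add_cancel, neg_add_cancel, opA_zero, opB_zero,
    mul_one]

/-! ### The core algebra and its states -/

variable (X 𝔾) in
/-- The linear span of the monomials `A_t B_γ`. As the monomials form a group of unitaries, it is a
*-algebra. -/
def monomialSpan : StarSubalgebra ℂ (Alg X 𝔾) where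
  carrier := Submodule.span ℂ
    (Set.range fun p : UpMap₀ X 𝔾 (-1) × DownMap₀ X 𝔾 1 => opA p.1 * opB p.2)
  add_mem' := add_mem
  mul_mem' := by
    intro a b ha hb
    have h := Submodule.mul_mem_mul ha hb
    rw [Submodule.span_mul_span] at h
    refine Submodule.span_mono ?_ h
    rintro _ ⟨_, ⟨p, rfl⟩, _, ⟨q, rfl⟩, rfl⟩
    exact ⟨p + q, (opA_mul_opB_mul _ _ _ _).symm⟩
  algebraMap_mem' := fun r => by
    rw [Algebra.algebraMap_eq_smul_one]
    exact Submodule.smul_mem _ _ (Submodule.subset_span ⟨0, by simp [opA_zero, opB_zero]⟩)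
  star_mem' := by
    intro a ha
    induction ha using Submodule.span_induction with
    | mem x hx =>
      obtain ⟨p, rfl⟩ := hx
      exact Submodule.subset_span ⟨-p, (star_opA_mul_opB _ _).symm⟩
    | zero => rw [star_zero]; exact zero_mem _
    | add x y _ _ hx hy => rw [star_add]; exact add_mem hx hy
    | smul r x _ hx => rw [star_smul]; exact Submodule.smul_mem _ _ hx

theorem adjoin_le_monomialSpan :
    StarAlgebra.adjoin ℂ (Set.range (opA (X := X) (𝔾 := 𝔾)) ∪ Set.range opB) ≤
      monomialSpan X 𝔾 := by
  refine StarAlgebra.adjoin_le ?_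
  rintro _ (⟨t, rfl⟩ | ⟨γ, rfl⟩)
  · exact Submodule.subset_span ⟨(t, 0), by simp [opB_zero]⟩
  · exact Submodule.subset_span ⟨(0, γ), by simp [opA_zero]⟩

/-- A state of the core algebra is determined by its values on the monomials. -/
theorem core_state_ext {ϑ ϑ' : core X 𝔾 →ₗ[ℂ] ℂ} (h : IsState ϑ) (h' : IsState ϑ')
    (heq : ∀ t γ, ϑ (coreMonomial t γ) = ϑ' (coreMonomial t γ)) : ϑ = ϑ' := by
  have hspan : ∀ a ∈ Submodule.span ℂ (Set.range fun p : UpMap₀ X 𝔾 (-1) × DownMap₀ X 𝔾 1 =>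
      opA p.1 * opB p.2), ∀ ha : a ∈ core X 𝔾, ϑ ⟨a, ha⟩ = ϑ' ⟨a, ha⟩ := by
    intro a ha hc
    have hle : Submodule.span ℂ (Set.range fun p : UpMap₀ X 𝔾 (-1) × DownMap₀ X 𝔾 1 =>
        opA p.1 * opB p.2) ≤
        (LinearMap.eqLocus ϑ ϑ').map (core X 𝔾).subtype.toAlgHom.toLinearMap :=
      Submodule.span_le.2 fun _ ⟨p, hp⟩ => ⟨coreMonomial p.1 p.2, heq _ _, hp⟩
    obtain ⟨b, hb, rfl⟩ := hle ha
    exact hb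
  ext a
  have hcl : a.1 ∈ closure ((StarAlgebra.adjoin ℂ
      (Set.range (opA (X := X) (𝔾 := 𝔾)) ∪ Set.range opB) : StarSubalgebra ℂ (Alg X 𝔾)) :
        Set (Alg X 𝔾)) := a.2
  obtain ⟨u, hu, hlim⟩ := mem_closure_iff_seq_limit.1 hcl
  have huc : ∀ n, u n ∈ core X 𝔾 := fun n => StarSubalgebra.le_topologicalClosure _ (hu n)
  have hlim' : Filter.Tendsto (fun n => (⟨u n, huc n⟩ : core X 𝔾)) Filter.atTop (nhds a) :=
    tendsto_subtype_rng.2 hlim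
  refine tendsto_nhds_unique ((h.continuous.tendsto a).comp hlim') ?_
  refine ((h'.continuous.tendsto a).comp hlim').congr fun n => ?_
  exact (hspan _ (adjoin_le_monomialSpan (hu n)) _).symm

theorem star_coreMonomial_mul_self (t : UpMap₀ X 𝔾 (-1)) (γ : DownMap₀ X 𝔾 1) :
    star (coreMonomial t γ) * coreMonomial t γ = 1 :=
  Subtype.ext (star_opA_mul_opB_mul_self t γ)

/-- The seed state is pure because its values `1` on unitaries are extreme in the unit disc. -/
theorem IsSeedState.isPureState {ϑ : core X 𝔾 →ₗ[ℂ] ℂ} (h : IsSeedState ϑ) : IsPureState ϑ := by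
  refine ⟨h.1, fun ϑ₁ h₁ ϑ₂ h₂ hseg => core_state_ext h₁ h.1 fun t γ => ?_⟩
  obtain ⟨a, b, ha, hb, hab, rfl⟩ := hseg
  rw [h.2]
  exact eq_one_of_convex_combination ha hb hab
    (IsState.norm_unitary_le h₁ (star_coreMonomial_mul_self t γ))
    (IsState.norm_unitary_le h₂ (star_coreMonomial_mul_self t γ)) (h.2 t γ)

theorem isState_restrictCore {ω : Alg X 𝔾 →ₗ[ℂ] ℂ} (h : IsState ω) : IsState (restrictCore ω) :=
  ⟨fun A => h.1 A.1, h.2⟩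

/-! ### Expectation one on the star and plaquette operators -/

theorem starOp_eq_one_iff {ω : Alg X 𝔾 →ₗ[ℂ] ℂ} (hω : IsState ω) :
    (∀ x, ω (starOp 𝔾 x) = 1) ↔ ∀ t : UpMap₀ X 𝔾 (-1), ω (opA t) = 1 := by
  constructor
  · intro h
    let S : AddSubgroup (UpMap₀ X 𝔾 (-1)) :=
      { carrier := {t | ω (opA t) = 1}
        zero_mem' := by rw [Set.mem_ofPred_eq, opA_zero, hω.2]
        add_mem' := fun {s t} hs ht => by
          rw [Set.mem_ofPred_eq, opA_add, IsState.map_mul_unitary hω (star_opA_mul_self t) ht]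
          exact hs
        neg_mem' := fun {t} ht => by
          rw [Set.mem_ofPred_eq, ← star_opA, IsState.map_star hω]
          exact (congrArg star ht).trans (star_one ℂ) }
    refine fun t => mem_of_locUp₀_mem (S := S) (fun x q hx g => ?_) t
    obtain rfl : q = dim x + 1 := by lia
    exact IsState.map_eq_one_of_average hω rfl
      (fun g : 𝔾.grp (dim x + 1) => opA (locUp₀ x (add_neg_cancel_right _ _) g))
      (fun _ => star_opA_mul_self _) (h x) g
  · intro h x
    exact IsState.map_average_eq_one rfl _ fun g => h _

theorem plaqOp_eq_one_iff {ω : Alg X 𝔾 →ₗ[ℂ] ℂ} (hω : IsState ω) :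
    (∀ x, ω (plaqOp 𝔾 x) = 1) ↔ ∀ γ : DownMap₀ X 𝔾 1, ω (opB γ) = 1 := by
  constructor
  · intro h
    let S : AddSubgroup (DownMap₀ X 𝔾 1) :=
      { carrier := {γ | ω (opB γ) = 1}
        zero_mem' := by rw [Set.mem_ofPred_eq, opB_zero, hω.2]
        add_mem' := fun {s t} hs ht => by
          rw [Set.mem_ofPred_eq, opB_add, IsState.map_mul_unitary hω (star_opB_mul_self t) ht]
          exact hs
        neg_mem' := fun {t} ht => by
          rw [Set.mem_ofPred_eq, ← star_opB, IsState.map_star hω]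
          exact (congrArg star ht).trans (star_one ℂ) }
    refine fun t => mem_of_locDown₀_mem (S := S) (fun x q hx α => ?_) t
    obtain rfl : q = dim x - 1 := by lia
    exact IsState.map_eq_one_of_average hω AddChar.card_eq
      (fun α : 𝔾.dual (dim x - 1) => opB (locDown₀ x (sub_add_cancel _ _) α))
      (fun _ => star_opB_mul_self _) (h x) α
  · intro h x
    exact IsState.map_average_eq_one AddChar.card_eq _ fun g => h _

end Core

section Existence

/-! ### Vector states -/

/-- The vector state `A ↦ ⟨v, A v⟩ / ‖v‖²` has the value `1` at every operator that fixes `v`. -/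
theorem exists_isState_of_fixed {ι : Type*} {G : ι → Type*} [∀ i, AddCommGroup (G i)]
    [∀ i, Finite (G i)] {v : Hilb G} (hv : v ≠ 0) :
    ∃ ω : quasiLocal G →ₗ[ℂ] ℂ, IsState ω ∧ ∀ A : quasiLocal G, A.1 v = v → ω A = 1 := by
  let ω : quasiLocal G →ₗ[ℂ] ℂ :=
    { toFun := fun A => ((‖v‖ ^ 2 : ℝ) : ℂ)⁻¹ * inner ℂ v (A.1 v)
      map_add' := fun A B => by
        rw [← mul_add, ← inner_add_right]
        rfl
      map_smul' := fun r A => by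
        change _ * inner ℂ v (r • A.1 v) = r * _
        rw [inner_smul_right]
        ring }
  have hinner : ∀ w : Hilb G, inner ℂ w w = ((‖w‖ ^ 2 : ℝ) : ℂ) := fun w => by
    rw [inner_self_eq_norm_sq_to_K]
    exact (Complex.ofReal_pow _ _).symm
  have hfix : ∀ A : quasiLocal G, A.1 v = v → ω A = 1 := by
    intro A hA
    change _ * inner ℂ v (A.1 v) = 1
    rw [hA, hinner]
    refine inv_mul_cancel₀ ?_
    exact_mod_cast pow_ne_zero 2 (norm_ne_zero_iff.2 hv)
  refine ⟨ω, ⟨fun A => ?_, hfix 1 rfl⟩, hfix⟩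
  have h : inner ℂ v ((star A * A).1 v) = inner ℂ (A.1 v) (A.1 v) :=
    ContinuousLinearMap.adjoint_inner_right A.1 v (A.1 v)
  change 0 ≤ _ * inner ℂ v ((star A * A).1 v)
  rw [h, hinner, ← Complex.ofReal_inv, ← Complex.ofReal_mul]
  exact_mod_cast by positivity

variable {V : Type*} [LinearOrder V] {N L : ℕ} {X : RegularComplex V N L} {𝔾 : AlgebraicData N}

variable (X 𝔾) in
/-- The group of configurations has finite exponent, because only the finitely many finite groups
`𝔾_0, …, 𝔾_N` occur as labels. -/
theorem exists_pos_nsmul_conf_eq_zero : ∃ M : ℕ, 0 < M ∧ ∀ c : Conf (Site X 𝔾), M • c = 0 := by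
  refine ⟨∏ j ∈ Finset.Icc (0 : ℤ) N, Fintype.card (𝔾.grp j),
    Finset.prod_pos fun _ _ => Fintype.card_pos, fun c => funext fun x => ?_⟩
  have hx : dim x ∈ Finset.Icc (0 : ℤ) N := by
    have h1 := X.card_le x.1 x.2
    have h2 := Finset.card_pos.2 (X.isRelLowerSet_faces x.2).1
    simp only [Finset.mem_Icc, dim]
    lia
  obtain ⟨m, hm⟩ := Finset.dvd_prod_of_mem (fun j => Fintype.card (𝔾.grp j)) hx
  simp only [Pi.smul_apply]
  rw [hm, mul_comm, mul_smul, card_nsmul_eq_zero, smul_zero]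
  rfl

theorem finite_closure_conf {s : Set (Conf (Site X 𝔾))} (hs : s.Finite) :
    Finite (AddSubgroup.closure s) := by
  have : Finite s := hs
  obtain ⟨M, hM, h⟩ := exists_pos_nsmul_conf_eq_zero X 𝔾
  refine AddCommGroup.finite_of_fg_isAddTorsion _ fun c => ?_
  exact isOfFinAddOrder_iff_nsmul_eq_zero.2 ⟨M, hM, Subtype.ext (h c.1)⟩

/-- The finite group of configurations generated by finitely many `δ^{-1} t`. -/
theorem exists_finite_subgroup {s : Set (UpMap₀ X 𝔾 (-1))} (hs : s.Finite) :
    ∃ F : AddSubgroup (Conf (Site X 𝔾)), (F : Set (Conf (Site X 𝔾))).Finite ∧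
      (∀ t ∈ s, upValue (coboundary (-1) 0 (by norm_num) t.1) ∈ F) ∧
      ∀ γ : DownMap₀ X 𝔾 1, ∀ c ∈ F, phase (boundary₀ 1 0 (by norm_num) γ).1 c = 1 := by
  refine ⟨AddSubgroup.closure
      ((fun t : UpMap₀ X 𝔾 (-1) => upValue (coboundary (-1) 0 (by norm_num) t.1)) '' s),
    finite_closure_conf (hs.image _), fun t ht => AddSubgroup.subset_closure ⟨t, ht, rfl⟩,
    fun γ c hc => ?_⟩
  induction hc using AddSubgroup.closure_induction with
  | mem c hc =>
    obtain ⟨t, -, rfl⟩ := hc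
    exact phase_boundary_coboundary γ t.1
  | zero => exact phase_zero_right _
  | add c c' _ _ h h' => rw [phase_add_right, h, h', one_mul]
  | neg c _ h =>
    have h' := phase_add_right (boundary₀ 1 0 (by norm_num) γ) c (-c)
    rw [h, one_mul, add_neg_cancel, phase_zero_right] at h'
    exact h'.symm

/-- Finitely many of the conditions `ω (A_t B_γ) = 1` are satisfied by a vector state: the uniform
superposition of the elements of the finite group of configurations generated by the
`δ^{-1} t` is fixed by the corresponding `A_t`, and by all `B_γ`. -/
theorem exists_isState_of_finset (s : Finset (UpMap₀ X 𝔾 (-1) × DownMap₀ X 𝔾 1)) :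
    ∃ ω : Alg X 𝔾 →ₗ[ℂ] ℂ, IsState ω ∧ ∀ p ∈ s, ω (opA p.1 * opB p.2) = 1 := by
  classical
  obtain ⟨F, hF, hFu, hFphase⟩ :=
    exists_finite_subgroup (s.finite_toSet.image Prod.fst)
  let v : Hilb (Site X 𝔾) := ⟨fun c => if c ∈ F then 1 else 0, memlp_of_sq
    (summable_of_hasFiniteSupport (hF.subset fun c hc => by
      by_contra h
      exact hc (by simp [show c ∉ F from h])))⟩
  have hv_apply : ∀ c, v c = if c ∈ F then 1 else 0 := fun _ => rfl
  have hv : v ≠ 0 := fun h => by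
    have := hv_apply 0
    rw [h, if_pos F.zero_mem] at this
    exact zero_ne_one this
  have hA : ∀ p ∈ s, (opA p.1).1 v = v := by
    intro p hp
    have hu := hFu p.1 ⟨p, hp, rfl⟩
    ext c
    rw [opA_apply, hv_apply, hv_apply]
    refine if_congr ⟨fun h => ?_, fun h => sub_mem h hu⟩ rfl rfl
    have h' := add_mem h hu
    rwa [sub_add_cancel] at h'
  have hB : ∀ γ : DownMap₀ X 𝔾 1, (opB γ).1 v = v := by
    intro γ
    ext c
    rw [opB_apply, hv_apply]
    split_ifs with hc
    · rw [mul_one, hFphase γ c hc]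
    · rw [mul_zero]
  obtain ⟨ω, hω, hfix⟩ := exists_isState_of_fixed hv
  refine ⟨ω, hω, fun p hp => hfix _ ?_⟩
  change (opA p.1).1 ((opB p.2).1 v) = v
  rw [hB, hA p hp]

variable (X 𝔾) in
theorem exists_isPureState_opA_mul_opB :
    ∃ ω : Alg X 𝔾 →ₗ[ℂ] ℂ, IsPureState ω ∧
      ∀ (t : UpMap₀ X 𝔾 (-1)) (γ : DownMap₀ X 𝔾 1), ω (opA t * opB γ) = 1 := by
  obtain ⟨ω, hpure, hω⟩ := exists_isPureState_of_finite
    (U := fun p : UpMap₀ X 𝔾 (-1) × DownMap₀ X 𝔾 1 => opA p.1 * opB p.2)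
    (fun p => star_opA_mul_opB_mul_self p.1 p.2) exists_isState_of_finset
  exact ⟨ω, hpure, fun t γ => hω (t, γ)⟩

end Existence

section GroundStates

variable {V : Type*} [LinearOrder V] {N L : ℕ} {X : RegularComplex V N L} {𝔾 : AlgebraicData N}

/-! ### The characterization of frustration-free ground states -/

theorem locUp₀_add {p q : ℤ} (x : X.Simplex) (hx : q + p = dim x) (g h : 𝔾.grp q) :
    locUp₀ x hx (g + h) = locUp₀ x hx g + locUp₀ x hx h := by
  refine Subtype.ext (funext fun ⟨⟨n, q'⟩, hi⟩ => Finsupp.addHom_ext' fun ⟨y, hy⟩ =>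
    AddMonoidHom.ext_int ?_)
  change locUp x hx (g + h) ⟨(n, q'), hi⟩ (gen ⟨y, hy⟩) =
    locUp x hx g ⟨(n, q'), hi⟩ (gen ⟨y, hy⟩) + locUp x hx h ⟨(n, q'), hi⟩ (gen ⟨y, hy⟩)
  simp only [locUp, gen, liftChain_single]
  split_ifs with h'
  · subst h'
    obtain rfl : dim y = n := hy
    obtain rfl : q' = q := by simp only at hi; lia
    rfl
  · rw [add_zero]

theorem locDown₀_add {p q : ℤ} (x : X.Simplex) (hx : q + p = dim x) (α β : 𝔾.dual q) :
    locDown₀ x hx (α + β) = locDown₀ x hx α + locDown₀ x hx β := by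
  refine Subtype.ext (funext fun ⟨⟨n, q'⟩, hi⟩ => Finsupp.addHom_ext' fun ⟨y, hy⟩ =>
    AddMonoidHom.ext_int ?_)
  change locDown x hx (α + β) ⟨(n, q'), hi⟩ (gen ⟨y, hy⟩) =
    locDown x hx α ⟨(n, q'), hi⟩ (gen ⟨y, hy⟩) + locDown x hx β ⟨(n, q'), hi⟩ (gen ⟨y, hy⟩)
  simp only [locDown, gen, liftChain_single]
  split_ifs with h'
  · subst h'
    obtain rfl : dim y = n := hy
    obtain rfl : q' = q := by simp only at hi; lia
    rfl
  · rw [add_zero]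

theorem locUp₀_neg {p q : ℤ} (x : X.Simplex) (hx : q + p = dim x) (g : 𝔾.grp q) :
    locUp₀ x hx (-g) = -locUp₀ x hx g :=
  (AddMonoidHom.mk' _ (locUp₀_add x hx)).map_neg g

theorem locDown₀_neg {p q : ℤ} (x : X.Simplex) (hx : q + p = dim x) (α : 𝔾.dual q) :
    locDown₀ x hx (-α) = -locDown₀ x hx α :=
  (AddMonoidHom.mk' _ (locDown₀_add x hx)).map_neg α

theorem star_starOp (x : X.Simplex) : star (starOp 𝔾 x) = starOp 𝔾 x :=
  star_average fun g => by rw [star_opA, locUp₀_neg]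

theorem starOp_mul_self (x : X.Simplex) : starOp 𝔾 x * starOp 𝔾 x = starOp 𝔾 x :=
  average_mul_average rfl fun g h => by rw [locUp₀_add, opA_add]

theorem star_plaqOp (x : X.Simplex) : star (plaqOp 𝔾 x) = plaqOp 𝔾 x :=
  star_average fun g => by rw [star_opB, locDown₀_neg]

theorem plaqOp_mul_self (x : X.Simplex) : plaqOp 𝔾 x * plaqOp 𝔾 x = plaqOp 𝔾 x :=
  average_mul_average AddChar.card_eq fun g h => by rw [locDown₀_add, opB_add]

/-- Each term of `-H^Λ` is a projection, so a state that gives them all the value `1` minimizes the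
energy locally. -/
theorem isGroundState_of_eq_one {ω : Alg X 𝔾 →ₗ[ℂ] ℂ} (hω : IsState ω)
    (hA : ∀ x, ω (starOp 𝔾 x) = 1) (hB : ∀ y, ω (plaqOp 𝔾 y) = 1) : IsGroundState ω := by
  refine ⟨hω, fun A hloc => ?_⟩
  obtain ⟨Λ, hΛ⟩ := (derivation_eq hloc).exists
  have e : -Complex.I * ω (star A * derivation A) =
      ω (star A * A * -hamiltonian X 𝔾 Λ) - ω (star A * -hamiltonian X 𝔾 Λ * A) := by
    rw [hΛ, mul_smul_comm, map_smul, smul_eq_mul, ← mul_assoc, neg_mul, Complex.I_mul_I, neg_neg,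
      one_mul, mul_sub, map_sub, mul_neg, mul_neg, neg_mul, map_neg, map_neg, mul_assoc, mul_assoc]
    ring
  rw [e, hamiltonian, neg_neg, mul_add, mul_add, add_mul, map_add, map_add, add_sub_add_comm]
  simp only [Finset.mul_sum, Finset.sum_mul, map_sum]
  rw [← Finset.sum_sub_distrib, ← Finset.sum_sub_distrib]
  exact add_nonneg
    (Finset.sum_nonneg fun x _ => IsState.projection_inequality hω (star_starOp x)
      (starOp_mul_self x) (hA x) A)
    (Finset.sum_nonneg fun y _ => IsState.projection_inequality hω (star_plaqOp y)
      (plaqOp_mul_self y) (hB y) A)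

theorem isFrustrationFree_iff {ω : Alg X 𝔾 →ₗ[ℂ] ℂ} (hω : IsState ω) :
    IsFrustrationFree ω ↔
      ∀ (t : UpMap₀ X 𝔾 (-1)) (γ : DownMap₀ X 𝔾 1), ω (opA t * opB γ) = 1 := by
  constructor
  · rintro ⟨-, h⟩ t γ
    have hA := (starOp_eq_one_iff hω).1 fun x => (h x x).1
    have hB := (plaqOp_eq_one_iff hω).1 fun x => (h x x).2
    rw [IsState.map_mul_unitary hω (star_opB_mul_self γ) (hB γ)]
    exact hA t
  · intro h
    have hA := (starOp_eq_one_iff hω).2 fun t => by simpa [opB_zero] using h t 0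
    have hB := (plaqOp_eq_one_iff hω).2 fun γ => by simpa [opA_zero] using h 0 γ
    exact ⟨isGroundState_of_eq_one hω hA hB, fun x y => ⟨hA x, hB y⟩⟩

end GroundStates

end QDM

end

theorem mainTheorem2 {V : Type*} [LinearOrder V] {N L : ℕ} (X : QDM.RegularComplex V N L)
    (𝔾 : QDM.AlgebraicData N) :
    -- frustration-free ground states exist
    (∃ ω : QDM.Alg X 𝔾 →ₗ[ℂ] ℂ, QDM.IsFrustrationFree ω) ∧
    -- pure frustration-free ground states exist
    (∃ ω : QDM.Alg X 𝔾 →ₗ[ℂ] ℂ, QDM.IsFrustrationFree ω ∧ QDM.IsPureState ω) ∧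
    -- the seed state exists, is unique and pure, and characterizes them
    ∃ ϑ : QDM.core X 𝔾 →ₗ[ℂ] ℂ,
      QDM.IsSeedState ϑ ∧ (∀ ϑ', QDM.IsSeedState ϑ' → ϑ' = ϑ) ∧ QDM.IsPureState ϑ ∧
      ∀ ω : QDM.Alg X 𝔾 →ₗ[ℂ] ℂ, QDM.IsState ω →
        (QDM.IsFrustrationFree ω ↔ QDM.restrictCore ω = ϑ) ∧
        (QDM.IsFrustrationFree ω ↔
          ∀ (t : QDM.UpMap₀ X 𝔾 (-1)) (γ : QDM.DownMap₀ X 𝔾 1),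
            ω (QDM.opA t * QDM.opB γ) = 1) := by
  obtain ⟨ω, hpure, hω⟩ := QDM.exists_isPureState_opA_mul_opB X 𝔾
  have hff : QDM.IsFrustrationFree ω :=
    (QDM.isFrustrationFree_iff hpure.1).2 hω
  have hseed : QDM.IsSeedState (QDM.restrictCore ω) :=
    ⟨QDM.isState_restrictCore hpure.1, hω⟩
  refine ⟨⟨ω, hff⟩, ⟨ω, hff, hpure⟩, QDM.restrictCore ω, hseed, fun ϑ' h => ?_,
    hseed.isPureState, fun ω' hω' => ⟨?_, QDM.isFrustrationFree_iff hω'⟩⟩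
  · exact QDM.core_state_ext h.1 hseed.1 fun t γ => (h.2 t γ).trans (hseed.2 t γ).symm
  · rw [QDM.isFrustrationFree_iff hω']
    constructor
    · intro h
      exact QDM.core_state_ext (QDM.isState_restrictCore hω') hseed.1 fun t γ =>
        (h t γ).trans (hseed.2 t γ).symm
    · intro h t γ
      exact (LinearMap.congr_fun h (QDM.coreMonomial t γ)).trans (hseed.2 t γ)
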